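/- Let $B$ be a unital real Banach algebra (for instance an algebra of bounded operators), let $A=C(\mathbb R,B)$ be the algebra of continuous $B$-valued functions, and let $R:A\to A$, $R(f)(t)=\int_0^t f(s)\,ds$, be the indefinite Riemann integral. Let $a\in A$. Let $A[[\lambda]]$ be the algebra of formal power series in a central parameter $\lambda$, with the complete filtration $A^n=\lambda^nA[[\lambda]]$, and let $R$ and $d/dt$ act on series coefficientwise. Write $\operatorname{ad}y=[y,\cdot\,]$ and $\frac{\operatorname{ad}y}{e^{\operatorname{ad}y}-1}=\sum_{m\ge0}\frac{B_m}{m!}(\operatorname{ad}y)^m$, with $B_m$ the Bernoulli numbers ($B_1=-\tfrac12$). Then: 1. The weight-zero CBHD recursion $$\chi=\frac{\operatorname{ad}R(\chi)}{e^{\operatorname{ad}R(\chi)}-1}(\lambda a)$$ has a unique solution $\chi=\chi^0(\lambda a)=\sum_{n\ge1}\chi^0_n(a)\lambda^n$ in $A^1=\lambda A[[\lambda]]$, and it is the limit, in the filtration topology, of the iterates $c_0=\lambda a$, $c_{k+1}=\frac{\operatorname{ad}R(c_k)}{e^{\operatorname{ad}R(c_k)}-1}(\lambda a)$. 2. (Order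 by order in $a$.) There is exactly one $\Omega\in\lambda A[[\lambda]]$ with $\Omega(0)=0$ such that $F=\exp\Omega$ satisfies $\frac{dF}{dt}=\lambda aF$, $F(0)=1$ (Magnus' exponent $\Omega[\lambda a]=\sum_{n\ge1}\Omega_n[a]\lambda^n$). There is also exactly one $\Omega\in\lambda A[[\lambda]]$ with $\Omega(0)=0$ and $\frac{d\Omega}{dt}=\frac{\operatorname{ad}\Omega}{e^{\operatorname{ad}\Omega}-1}(\lambda a)$ (Magnus' differential equation). Both are equal to $R(\chi^0(\lambda a))$: $$\Omega[\lambda a](t)=R\bigl(\chi^0(\lambda a)\bigr)(t),\qquad\text{i.e. } \Omega_n[a]=R(\chi^0_n(a))\text{ for all }n\ge1.$$ 3. (Convergence.) Let $F:\mathbb R\to B$ be the solution of $F'=aF$, $F(0)=1$. If at some $t\in\mathbb R$ the partial sums of $\sum_{n\ge1}R(\chi^0_n(a))(t)$ converge to $L\in B$, then $F(t)=\exp(L)$. Moreover there is $\varepsilon>0$ such that for all $|t|\le\varepsilon$ the series $\chi^0(a)(t):=\sum_{n\ge1}\chi^0_n(a)(t)$ converges absolutely, its sum is continuous in $t$ on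 $[-\varepsilon,\varepsilon]$, $\sum_{n\ge1}R(\chi^0_n(a))(t)=R(\chi^0(a))(t)$, and, with a convergent series on the right, $$\chi^0(a)(t)=\sum_{m\ge0}\frac{B_m}{m!}\bigl(\operatorname{ad}R(\chi^0(a))(t)\bigr)^m\bigl(a(t)\bigr).$$ A continuous function $\Omega:[-\varepsilon,\varepsilon]\to B$ satisfies $\Omega(0)=0$ and $F(t)=\exp(\Omega(t))$ for all $|t|\le\varepsilon$ if and only if $$\Omega(t)=R\bigl(\chi^0(a)\bigr)(t)\qquad\text{for all }|t|\le\varepsilon .$$ -/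

import Mathlib

open Filter Topology

noncomputable section

namespace MagnusCBHD

/-! ### Filtered algebras: limits, series, exponential, and the weight-zero CBHD recursion -/

section Filtered

variable {S : Type*} [Ring S] [Algebra ℝ S]

/-- `x n → y` in the topology defined by the decreasing filtration `fil`. -/
def FilTendsto (fil : ℕ → Submodule ℝ S) (x : ℕ → S) (y : S) : Prop :=
  ∀ N : ℕ, ∀ᶠ n in atTop, x n - y ∈ fil N

/-- `∑ₘ u m = s` in the topology defined by the filtration `fil`. -/
def FilHasSum (fil : ℕ → Submodule ℝ S) (u : ℕ → S) (s : S) : Prop :=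
  FilTendsto fil (fun M => ∑ m ∈ Finset.range M, u m) s

/-- `E = exp x = ∑ₘ xᵐ / m!` in the topology defined by the filtration. -/
def IsFilExp (fil : ℕ → Submodule ℝ S) (x E : S) : Prop :=
  FilHasSum fil (fun m => ((m.factorial : ℝ)⁻¹) • x ^ m) E

/-- The `m`-th term `bₘ (ad y)ᵐ (a)` of `(ad y / (e ^ (ad y) - 1)) (a)`, where `bₘ = Bₘ / m!`,
`Bₘ` are the Bernoulli numbers (with `B₁ = -1/2`), and `ad y = [y, ·]`. -/
def bernoulliAdTerm (y a : S) (m : ℕ) : S :=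
  (((bernoulli m : ℚ) : ℝ) / (m.factorial : ℝ)) • ((fun z => y * z - z * y)^[m] a)

/-- `c = (ad y / (e ^ (ad y) - 1)) (a) = ∑ₘ bₘ (ad y)ᵐ (a)`, in the filtration topology. -/
def IsBernoulliAd (fil : ℕ → Submodule ℝ S) (y a c : S) : Prop :=
  FilHasSum fil (bernoulliAdTerm y a) c

/-- The weight-zero CBHD recursion for the linear map `P`: the element `χ` of the first
filtration step satisfies `χ = (ad P(χ) / (e ^ (ad P(χ)) - 1)) (a)`. -/
def IsZeroCBHD (fil : ℕ → Submodule ℝ S) (P : S →ₗ[ℝ] S) (a χ : S) : Prop :=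
  χ ∈ fil 1 ∧ IsBernoulliAd fil (P χ) a χ

/-- `c` is the sequence of iterates of the weight-zero CBHD recursion:
`c 0 = a` and `c (n + 1) = (ad P(c n) / (e ^ (ad P(c n)) - 1)) (a)`. -/
def IsZeroCBHDIteration (fil : ℕ → Submodule ℝ S) (P : S →ₗ[ℝ] S) (a : S) (c : ℕ → S) : Prop :=
  c 0 = a ∧ ∀ n, IsBernoulliAd fil (P (c n)) a (c (n + 1))

end Filtered

/-- The filtration of `A⟦X⟧` by the subspaces `Xⁿ A⟦X⟧`. -/
def orderFil (A : Type*) [Ring A] [Algebra ℝ A] (n : ℕ) : Submodule ℝ (PowerSeries A) where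
  carrier := {f | ∀ k < n, PowerSeries.coeff k f = 0}
  zero_mem' := by
    intro k _
    simp
  add_mem' := by
    intro f g hf hg k hk
    simp [hf k hk, hg k hk]
  smul_mem' := by
    intro r f hf k hk
    have h : PowerSeries.coeff k (r • f) = r • PowerSeries.coeff k f := rfl
    rw [h, hf k hk, smul_zero]

/-! ### Operator-valued functions and the indefinite Riemann integral -/

section Operator

variable {B : Type*} [NormedRing B] [NormedAlgebra ℝ B] [CompleteSpace B]

/-- The indefinite Riemann integral `R(f)(t) = ∫₀ᵗ f(s) ds` on continuous functions. -/
def riemann : C(ℝ, B) →ₗ[ℝ] C(ℝ, B) where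
  toFun f := ⟨fun t => ∫ s in (0 : ℝ)..t, f s,
    intervalIntegral.continuous_primitive (fun _ _ => f.continuous.intervalIntegrable _ _) 0⟩
  map_add' f g := by
    ext t
    exact intervalIntegral.integral_add (f.continuous.intervalIntegrable _ _)
      (g.continuous.intervalIntegrable _ _)
  map_smul' r f := by
    ext t
    exact intervalIntegral.integral_smul r _

/-- `R` acting on series through the coefficients. -/
def riemannSeries : PowerSeries C(ℝ, B) →ₗ[ℝ] PowerSeries C(ℝ, B) where
  toFun f := PowerSeries.mk fun n => riemann (PowerSeries.coeff n f)
  map_add' f g := by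
    ext1 n
    simp
  map_smul' r f := by
    ext1 n
    have h (g : PowerSeries C(ℝ, B)) :
        PowerSeries.coeff n (r • g) = r • PowerSeries.coeff n g := rfl
    simp [h]

/-- `dG/dt = H`, coefficient by coefficient. -/
def HasSeriesDeriv (G H : PowerSeries C(ℝ, B)) : Prop :=
  ∀ (n : ℕ) (t : ℝ),
    HasDerivAt (fun s => PowerSeries.coeff n G s) (PowerSeries.coeff n H t) t

/-- `G(0) = b` at time `t = 0`, for a constant `b` of the algebra. -/
def SeriesInitial (G : PowerSeries C(ℝ, B)) (b : PowerSeries B) : Prop :=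
  ∀ n : ℕ, PowerSeries.coeff n G 0 = PowerSeries.coeff n b

/-- Magnus' exponent, order by order in `a`: `a` is replaced by `X a` with a formal parameter `X`,
so that the coefficient of `Xⁿ` in `Ω` is the part `Ωₙ[a]` of degree `n` in `a`.
The series `Ω` has no term of degree zero, `Ω(0) = 0`, and `F = exp Ω` solves
`dF/dt = X a F`, `F(0) = 1`. -/
def IsMagnusExponent (a : C(ℝ, B)) (Ω : PowerSeries C(ℝ, B)) : Prop :=
  Ω ∈ orderFil C(ℝ, B) 1 ∧ SeriesInitial Ω 0 ∧
    ∃ F : PowerSeries C(ℝ, B), IsFilExp (orderFil C(ℝ, B)) Ω F ∧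
      SeriesInitial F 1 ∧ HasSeriesDeriv F (PowerSeries.monomial 1 a * F)

/-- Magnus' differential equation `dΩ/dt = (ad Ω / (e ^ (ad Ω) - 1)) (X a)`, `Ω(0) = 0`,
order by order in `a`. -/
def SolvesMagnusODE (a : C(ℝ, B)) (Ω : PowerSeries C(ℝ, B)) : Prop :=
  Ω ∈ orderFil C(ℝ, B) 1 ∧ SeriesInitial Ω 0 ∧
    ∃ D : PowerSeries C(ℝ, B),
      IsBernoulliAd (orderFil C(ℝ, B)) Ω (PowerSeries.monomial 1 a) D ∧ HasSeriesDeriv Ω D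

/-- `F : ℝ → B` solves `dF/dt = a F`, `F(0) = 1`. -/
def SolvesIVP (a : C(ℝ, B)) (F : ℝ → B) : Prop :=
  F 0 = 1 ∧ ∀ t : ℝ, HasDerivAt F (a t * F t) t

end Operator

end MagnusCBHD

end

noncomputable section

namespace MagnusCBHD

/-! ### Formal series of elements of increasing order -/

section Formal

variable {A : Type*} [Ring A] [Algebra ℝ A]

/-! The derivative of `exp Ω` is `((e^{ad Ω} - 1) / ad Ω)(Ω') · exp Ω`. Since `ad Ω / (e^{ad Ω} -
1)` inverts the first operator, Magnus' equation for `Ω` makes `exp Ω` solve `F' = λ a F`. Writing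
`Ω = R χ` with `χ = Ω'` turns Magnus' equation with `Ω(0) = 0` into the CBHD recursion for `χ`.

Formally, the right-hand side of the recursion gains one order because `λ a` has order one. It is
therefore a contraction for the filtration, with one fixed point `χ` that attracts the iterates
(`exists_fixedPoint_orderFil`). The formulas `powDeriv_eq_sum` and `sum_antidiagonal_bernoulli` give
`formalSum_powDeriv`, so `exp (R χ)` solves the linear equation. That equation has one solution,
determined degree by degree, and `formalExp_injOn` makes the exponent unique.

Analytically, a series is evaluated through an algebra map into a Banach algebra and controlled by
the `ℓ¹`-norm of its terms, which is submultiplicative. If the expansion merely converges at `t`,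
then inserting a parameter `r < 1` gives absolute convergence, the formal identity can be evaluated
there, and Abel's theorem lets `r → 1` (`eq_exp_of_tendsto_sum`). On a small interval the integral
contributes a factor `ε`, so a norm bound survives every iteration and passes to `χ`
(`seriesNorm_zeroCBHD_le`). Uniqueness of the continuous logarithm follows from injectivity of `exp`
near `0` and connectedness of the interval (`eqOn_of_exp_eq`). -/

theorem coeff_real_smul (n : ℕ) (r : ℝ) (f : PowerSeries A) :
    PowerSeries.coeff n (r • f) = r • PowerSeries.coeff n f := rfl

theorem orderFil_anti {m n : ℕ} (h : m ≤ n) {f : PowerSeries A} (hf : f ∈ orderFil A n) :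
    f ∈ orderFil A m := fun k hk => hf k (hk.trans_le h)

theorem mem_orderFil_zero (f : PowerSeries A) : f ∈ orderFil A 0 :=
  fun k hk => absurd hk (Nat.not_lt_zero k)

theorem mul_mem_orderFil {m n : ℕ} {f g : PowerSeries A} (hf : f ∈ orderFil A m)
    (hg : g ∈ orderFil A n) : f * g ∈ orderFil A (m + n) := by
  intro k hk
  rw [PowerSeries.coeff_mul]
  refine Finset.sum_eq_zero fun p hp => ?_
  rw [Finset.HasAntidiagonal.mem_antidiagonal] at hp
  by_cases h : p.1 < m
  · rw [hf _ h, zero_mul]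
  · rw [hg _ (by omega), mul_zero]

theorem pow_mem_orderFil {f : PowerSeries A} (hf : f ∈ orderFil A 1) (m : ℕ) :
    f ^ m ∈ orderFil A m := by
  induction m with
  | zero => exact mem_orderFil_zero _
  | succ m ih => rw [pow_succ]; exact mul_mem_orderFil ih hf

theorem monomial_mem_orderFil (a : A) : PowerSeries.monomial 1 a ∈ orderFil A 1 := by
  intro k hk
  rw [PowerSeries.coeff_monomial, if_neg (by omega)]

theorem eq_of_forall_sub_mem_orderFil {f g : PowerSeries A}
    (h : ∀ n, f - g ∈ orderFil A n) : f = g := by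
  ext n
  have := h (n + 1) n n.lt_succ_self
  rwa [map_sub, sub_eq_zero] at this

/-- The commutator `[y, ·]` as a linear endomorphism. -/
def adEnd {S : Type*} [Ring S] [Algebra ℝ S] (y : S) : Module.End ℝ S :=
  LinearMap.mulLeft ℝ y - LinearMap.mulRight ℝ y

theorem adEnd_apply {S : Type*} [Ring S] [Algebra ℝ S] (y z : S) :
    adEnd y z = y * z - z * y := rfl

theorem iterate_commutator {S : Type*} [Ring S] [Algebra ℝ S] (y z : S) (m : ℕ) :
    (fun z => y * z - z * y)^[m] z = (adEnd y ^ m) z := by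
  rw [Module.End.pow_apply]; rfl

theorem bernoulliAdTerm_eq {S : Type*} [Ring S] [Algebra ℝ S] (y z : S) (m : ℕ) :
    bernoulliAdTerm y z m =
      (((bernoulli m : ℚ) : ℝ) / (m.factorial : ℝ)) • (adEnd y ^ m) z := by
  rw [bernoulliAdTerm, iterate_commutator]

theorem adEnd_mem_orderFil {m n : ℕ} {y z : PowerSeries A} (hy : y ∈ orderFil A m)
    (hz : z ∈ orderFil A n) : adEnd y z ∈ orderFil A (m + n) :=
  Submodule.sub_mem _ (mul_mem_orderFil hy hz) (add_comm n m ▸ mul_mem_orderFil hz hy)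

theorem adEnd_pow_mem_orderFil {j : ℕ} {y z : PowerSeries A} (hy : y ∈ orderFil A 1)
    (hz : z ∈ orderFil A j) (m : ℕ) : (adEnd y ^ m) z ∈ orderFil A (m + j) := by
  induction m with
  | zero => simpa using hz
  | succ m ih =>
    rw [pow_succ', Module.End.mul_apply]
    exact orderFil_anti (by omega) (adEnd_mem_orderFil hy ih)

/-- Telescoping over the factors: each term contains `y - y'` once and `z` once. With `z = λ a`, so
`j = 1`, the extra order is what makes the CBHD recursion a contraction. -/
theorem adEnd_pow_sub_mem_orderFil {N j : ℕ} {y y' z : PowerSeries A}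
    (h : y - y' ∈ orderFil A N) (hy' : y' ∈ orderFil A 1) (hz : z ∈ orderFil A j) (m : ℕ) :
    (adEnd y ^ m) z - (adEnd y' ^ m) z ∈ orderFil A (N + j) := by
  induction m with
  | zero => simp
  | succ m ih =>
    have key : (adEnd y ^ (m + 1)) z - (adEnd y' ^ (m + 1)) z =
        adEnd y ((adEnd y ^ m) z - (adEnd y' ^ m) z) + adEnd (y - y') ((adEnd y' ^ m) z) := by
      simp only [pow_succ', Module.End.mul_apply, adEnd_apply]
      noncomm_ring
    rw [key]
    refine Submodule.add_mem _ ?_ ?_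
    · exact orderFil_anti (by omega) (adEnd_mem_orderFil (mem_orderFil_zero y) ih)
    · exact orderFil_anti (by omega)
        (adEnd_mem_orderFil h (adEnd_pow_mem_orderFil hy' hz m))

/-- The sum of a sequence of series whose `m`-th term has order at least `m`. -/
def formalSum (u : ℕ → PowerSeries A) : PowerSeries A :=
  PowerSeries.mk fun n => ∑ m ∈ Finset.range (n + 1), PowerSeries.coeff n (u m)

theorem coeff_formalSum {A : Type*} [Ring A] (u : ℕ → PowerSeries A) (n : ℕ) :
    PowerSeries.coeff n (formalSum u) =
      ∑ m ∈ Finset.range (n + 1), PowerSeries.coeff n (u m) :=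
  PowerSeries.coeff_mk _ _

theorem sum_range_coeff {u : ℕ → PowerSeries A} (hu : ∀ m, u m ∈ orderFil A m) {n M : ℕ}
    (h : n + 1 ≤ M) : ∑ m ∈ Finset.range M, PowerSeries.coeff n (u m) =
      PowerSeries.coeff n (formalSum u) := by
  rw [coeff_formalSum]
  symm
  refine Finset.sum_subset (Finset.range_mono h) fun m _ hm => ?_
  exact hu m n (by simpa using hm)

/-- Terms of index above `n` do not reach degree `n`, so each coefficient of the partial sums is
eventually constant. This replaces filtration limits by an explicit series, giving existence and
uniqueness of the sum at once. -/
theorem filHasSum_iff {u : ℕ → PowerSeries A} (hu : ∀ m, u m ∈ orderFil A m)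
    {s : PowerSeries A} : FilHasSum (orderFil A) u s ↔ s = formalSum u := by
  constructor
  · intro h
    ext n
    obtain ⟨M, hM, hM'⟩ := ((h (n + 1)).and (eventually_ge_atTop (n + 1))).exists
    have := hM n n.lt_succ_self
    rw [map_sub, map_sum, sum_range_coeff hu hM', sub_eq_zero] at this
    exact this.symm
  · rintro rfl N
    filter_upwards [eventually_ge_atTop N] with M hM k hk
    rw [map_sub, map_sum, sum_range_coeff hu (by omega), sub_self]

theorem formalSum_mem_orderFil {u : ℕ → PowerSeries A} {N : ℕ} (hu : ∀ m, u m ∈ orderFil A N) :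
    formalSum u ∈ orderFil A N := by
  intro k hk
  rw [coeff_formalSum]
  exact Finset.sum_eq_zero fun m _ => hu m k hk

theorem formalSum_sub (u v : ℕ → PowerSeries A) :
    formalSum (fun m => u m - v m) = formalSum u - formalSum v := by
  ext n
  simp [coeff_formalSum]

theorem formalSum_smul (r : ℝ) (u : ℕ → PowerSeries A) :
    formalSum (fun m => r • u m) = r • formalSum u := by
  ext n
  simp only [coeff_formalSum, coeff_real_smul, Finset.smul_sum]

theorem mul_formalSum {u : ℕ → PowerSeries A} (hu : ∀ m, u m ∈ orderFil A m)
    (w : PowerSeries A) : w * formalSum u = formalSum fun m => w * u m := by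
  ext n
  rw [PowerSeries.coeff_mul, coeff_formalSum]
  simp only [PowerSeries.coeff_mul]
  rw [Finset.sum_comm]
  refine Finset.sum_congr rfl fun p hp => ?_
  rw [Finset.HasAntidiagonal.mem_antidiagonal] at hp
  -- The inner sum for degree `p.2` stops at `p.2 + 1`; lengthening it to the common range `n + 1`
  -- adds only zeros.
  rw [← sum_range_coeff hu (show p.2 + 1 ≤ n + 1 by omega), Finset.mul_sum]

theorem formalSum_mul {u : ℕ → PowerSeries A} (hu : ∀ m, u m ∈ orderFil A m)
    (w : PowerSeries A) : formalSum u * w = formalSum fun m => u m * w := by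
  ext n
  rw [PowerSeries.coeff_mul, coeff_formalSum]
  simp only [PowerSeries.coeff_mul]
  rw [Finset.sum_comm]
  refine Finset.sum_congr rfl fun p hp => ?_
  rw [Finset.HasAntidiagonal.mem_antidiagonal] at hp
  rw [← sum_range_coeff hu (show p.1 + 1 ≤ n + 1 by omega), Finset.sum_mul]

theorem adEnd_pow_formalSum {u : ℕ → PowerSeries A} (hu : ∀ m, u m ∈ orderFil A m)
    {y : PowerSeries A} (hy : y ∈ orderFil A 1) (k : ℕ) :
    (adEnd y ^ k) (formalSum u) = formalSum fun m => (adEnd y ^ k) (u m) := by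
  induction k with
  | zero => simp
  | succ k ih =>
    have h (m : ℕ) : (adEnd y ^ k) (u m) ∈ orderFil A m :=
      orderFil_anti (by omega) (adEnd_pow_mem_orderFil hy (hu m) k)
    simp only [pow_succ', Module.End.mul_apply]
    rw [ih, adEnd_apply, mul_formalSum h, formalSum_mul h, ← formalSum_sub]
    rfl

/-- The square splits into the triangle `k + l < N`, grouped by diagonals, and a remainder on which
`f` vanishes. -/
theorem sum_range_sum_range_eq_antidiagonal {M : Type*} [AddCommMonoid M] (N : ℕ)
    (f : ℕ → ℕ → M) (hf : ∀ k l, N ≤ k + l → f k l = 0) :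
    ∑ k ∈ Finset.range N, ∑ l ∈ Finset.range N, f k l =
      ∑ j ∈ Finset.range N, ∑ p ∈ Finset.HasAntidiagonal.antidiagonal j, f p.1 p.2 := by
  rw [← Finset.sum_product', Finset.sum_sigma']
  symm
  refine Finset.sum_of_injOn (fun x => x.2) ?_ ?_ ?_ ?_
  · rintro ⟨j, p⟩ hx ⟨j', p'⟩ hx' h
    simp only [Finset.coe_sigma, Set.mem_sigma_iff, Finset.mem_coe, Finset.mem_range,
      Finset.HasAntidiagonal.mem_antidiagonal] at hx hx' h
    subst h
    obtain rfl : j = j' := hx.2.symm.trans hx'.2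
    rfl
  · rintro ⟨j, p⟩ hx
    simp only [Finset.coe_sigma, Set.mem_sigma_iff, Finset.mem_coe, Finset.mem_range,
      Finset.HasAntidiagonal.mem_antidiagonal] at hx
    simp only [Finset.coe_product, Set.mem_prod, Finset.mem_coe, Finset.mem_range]
    omega
  · rintro ⟨k, l⟩ hx hn
    refine hf k l ?_
    by_contra hlt
    exact hn ⟨⟨k + l, (k, l)⟩, by simpa using hlt, rfl⟩
  · intro x _
    rfl

theorem formalSum_formalSum {u : ℕ → ℕ → PowerSeries A}
    (hu : ∀ k l, u k l ∈ orderFil A (k + l)) :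
    (formalSum fun k => formalSum fun l => u k l) =
      formalSum fun n => ∑ p ∈ Finset.HasAntidiagonal.antidiagonal n, u p.1 p.2 := by
  ext n
  simp only [coeff_formalSum, map_sum]
  exact sum_range_sum_range_eq_antidiagonal (n + 1) (fun k l => PowerSeries.coeff n (u k l))
    fun k l h => hu k l n (by omega)

/-! ### The exponential of a formal series -/

/-- `exp x` for a series `x` without constant term. -/
def formalExp (x : PowerSeries A) : PowerSeries A :=
  formalSum fun m => ((m.factorial : ℝ)⁻¹) • x ^ m

theorem isFilExp_iff {x E : PowerSeries A} (hx : x ∈ orderFil A 1) :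
    IsFilExp (orderFil A) x E ↔ E = formalExp x :=
  filHasSum_iff fun m => Submodule.smul_mem _ _ (pow_mem_orderFil hx m)

theorem pow_sub_pow_mem_orderFil {N : ℕ} {x y : PowerSeries A} (h : x - y ∈ orderFil A N)
    (m : ℕ) : x ^ m - y ^ m ∈ orderFil A N := by
  induction m with
  | zero => simp
  | succ m ih =>
    have key : x ^ (m + 1) - y ^ (m + 1) = x * (x ^ m - y ^ m) + (x - y) * y ^ m := by
      rw [pow_succ', pow_succ']; noncomm_ring
    rw [key]
    refine Submodule.add_mem _ ?_ ?_
    · exact orderFil_anti (by omega) (mul_mem_orderFil (mem_orderFil_zero x) ih)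
    · exact orderFil_anti (by omega) (mul_mem_orderFil h (mem_orderFil_zero _))

/-- Each term of the telescoped difference has, besides `x - y`, another factor of order one. Only
`m = 1` lacks it. -/
theorem pow_sub_pow_mem_orderFil_succ {N : ℕ} {x y : PowerSeries A} (hx : x ∈ orderFil A 1)
    (hy : y ∈ orderFil A 1) (h : x - y ∈ orderFil A N) {m : ℕ} (hm : m ≠ 1) :
    x ^ m - y ^ m ∈ orderFil A (N + 1) := by
  rcases m with _ | m
  · simp
  · have key : x ^ (m + 1) - y ^ (m + 1) = x * (x ^ m - y ^ m) + (x - y) * y ^ m := by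
      rw [pow_succ', pow_succ']; noncomm_ring
    rw [key]
    refine Submodule.add_mem _ ?_ ?_
    · exact orderFil_anti (by omega) (mul_mem_orderFil hx (pow_sub_pow_mem_orderFil h m))
    · exact orderFil_anti (by omega) (mul_mem_orderFil h (pow_mem_orderFil hy m))

/-- Induction on the order: if `x` and `y` agree below degree `k`, then in degree `k` the difference
of their exponentials is that of the linear terms. -/
theorem formalExp_injOn {x y : PowerSeries A} (hx : x ∈ orderFil A 1) (hy : y ∈ orderFil A 1)
    (h : formalExp x = formalExp y) : x = y := by
  refine eq_of_forall_sub_mem_orderFil fun N => ?_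
  induction N with
  | zero => exact mem_orderFil_zero _
  | succ N ih =>
    intro k hk
    rcases Nat.lt_succ_iff_lt_or_eq.mp hk with hk | rfl
    · exact ih k hk
    rcases Nat.eq_zero_or_pos k with rfl | hk0
    · rw [map_sub, hx 0 one_pos, hy 0 one_pos, sub_zero]
    have h' := congrArg (PowerSeries.coeff k) (sub_eq_zero.mpr h)
    rw [formalExp, formalExp, ← formalSum_sub, coeff_formalSum,
      Finset.sum_eq_single 1 ?_ (fun h1 => absurd (Finset.mem_range.mpr (by omega)) h1)] at h'
    · simpa using h'
    · intro m _ hm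
      rw [← smul_sub, coeff_real_smul,
        pow_sub_pow_mem_orderFil_succ hx hy ih hm k k.lt_succ_self, smul_zero]

/-! ### The derivative of powers and of the exponential, and the Bernoulli identity -/

/-- Left multiplication by `y` is `ad y` plus right multiplication by `y`. These commute, so the
binomial theorem applies. -/
theorem pow_mul_eq_sum_adEnd {S : Type*} [Ring S] [Algebra ℝ S] (y z : S) (n : ℕ) :
    y ^ n * z =
      ∑ k ∈ Finset.range (n + 1), (n.choose k : ℝ) • ((adEnd y ^ k) z * y ^ (n - k)) := by
  have hc : Commute (adEnd y) (LinearMap.mulRight ℝ y) :=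
    Commute.sub_left (LinearMap.commute_mulLeft_right (R := ℝ) y y) (Commute.refl _)
  have h : LinearMap.mulLeft ℝ y = adEnd y + LinearMap.mulRight ℝ y := by
    rw [adEnd, sub_add_cancel]
  have h2 := congrArg (fun f : Module.End ℝ S => f z)
    ((congrArg (· ^ n) h).trans (hc.add_pow n))
  simp only [LinearMap.pow_mulLeft, LinearMap.mulLeft_apply] at h2
  rw [h2, LinearMap.sum_apply]
  refine Finset.sum_congr rfl fun k _ => ?_
  rw [(hc.pow_pow k (n - k)).eq, mul_assoc, Module.End.mul_apply, LinearMap.pow_mulRight,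
    LinearMap.mulRight_apply, Module.End.mul_apply, ← smul_mul_assoc]
  congr 1
  rw [Nat.cast_smul_eq_nsmul, Module.End.natCast_apply, map_nsmul]

/-- The derivative of `y ^ n` along `z`, that is `∑ yⁱ z yʲ` over `i + j + 1 = n`. -/
def powDeriv {S : Type*} [Ring S] (y z : S) : ℕ → S
  | 0 => 0
  | n + 1 => powDeriv y z n * y + y ^ n * z

/-- Pascal's rule applied to the recursion for `powDeriv`. Divided by `(n + 1)!`, the coefficient
becomes `1 / ((k + 1)! (n - k)!)`, the coefficient in the product of `(e^{ad y} - 1) / ad y` and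
`exp y`. -/
theorem powDeriv_eq_sum {S : Type*} [Ring S] [Algebra ℝ S] (y z : S) (n : ℕ) :
    powDeriv y z (n + 1) = ∑ k ∈ Finset.range (n + 1),
      ((n + 1).choose (k + 1) : ℝ) • ((adEnd y ^ k) z * y ^ (n - k)) := by
  induction n with
  | zero => simp [powDeriv]
  | succ n ih =>
    rw [powDeriv, ih, pow_mul_eq_sum_adEnd]
    have hlast : (∑ k ∈ Finset.range (n + 1),
        ((n + 1).choose (k + 1) : ℝ) • ((adEnd y ^ k) z * y ^ (n - k))) * y =
        ∑ k ∈ Finset.range (n + 2),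
          ((n + 1).choose (k + 1) : ℝ) • ((adEnd y ^ k) z * y ^ (n + 1 - k)) := by
      rw [Finset.sum_range_succ _ (n + 1), Finset.sum_mul, Nat.choose_succ_self]
      simp only [Nat.cast_zero, zero_smul, add_zero]
      refine Finset.sum_congr rfl fun k hk => ?_
      rw [Finset.mem_range] at hk
      rw [show n + 1 - k = (n - k) + 1 by omega, pow_succ, smul_mul_assoc, mul_assoc]
    rw [hlast, ← Finset.sum_add_distrib]
    refine Finset.sum_congr rfl fun k _ => ?_
    rw [← add_smul, Nat.choose_succ_succ (n + 1) k]
    push_cast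
    rw [add_comm]

theorem powDeriv_mem_orderFil {j : ℕ} {y z : PowerSeries A} (hy : y ∈ orderFil A 1)
    (hz : z ∈ orderFil A j) (n : ℕ) : powDeriv y z (n + 1) ∈ orderFil A (n + j) := by
  induction n with
  | zero => simpa [powDeriv] using hz
  | succ n ih =>
    rw [powDeriv]
    refine Submodule.add_mem _ ?_ ?_
    · exact orderFil_anti (by omega) (mul_mem_orderFil ih hy)
    · exact orderFil_anti (by omega) (mul_mem_orderFil (pow_mem_orderFil hy (n + 1)) hz)

/-- Coefficient form of `((e^x - 1) / x) · (x / (e^x - 1)) = 1`; it is the standard Bernoulli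
recursion divided by `(n + 1)!`. -/
theorem sum_antidiagonal_bernoulli (n : ℕ) :
    ∑ p ∈ Finset.HasAntidiagonal.antidiagonal n, (((p.1 + 1).factorial : ℝ)⁻¹ *
      (((bernoulli p.2 : ℚ) : ℝ) / (p.2.factorial : ℝ))) = if n = 0 then 1 else 0 := by
  have h := sum_bernoulli (n + 1)
  have h' : ∑ k ∈ Finset.range (n + 1), ((n + 1).choose k : ℝ) * ((bernoulli k : ℚ) : ℝ) =
      if n = 0 then 1 else 0 := by
    have := congrArg (fun q : ℚ => (q : ℝ)) h
    push_cast at this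
    rw [this]
    split_ifs <;> simp
  rw [← Finset.Nat.sum_antidiagonal_swap, Finset.Nat.sum_antidiagonal_eq_sum_range_succ_mk]
  have h2 : ∑ k ∈ Finset.range (n + 1), (((n - k + 1).factorial : ℝ)⁻¹ *
      (((bernoulli k : ℚ) : ℝ) / (k.factorial : ℝ))) =
      ((n + 1).factorial : ℝ)⁻¹ * if n = 0 then 1 else 0 := by
    rw [← h', Finset.mul_sum]
    refine Finset.sum_congr rfl fun k hk => ?_
    rw [Finset.mem_range] at hk
    rw [Nat.cast_choose ℝ (show k ≤ n + 1 by omega), show n + 1 - k = n - k + 1 by omega]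
    have h1 := Nat.cast_ne_zero (R := ℝ).mpr (Nat.factorial_ne_zero (n + 1))
    have h3 := Nat.cast_ne_zero (R := ℝ).mpr (Nat.factorial_ne_zero (n - k + 1))
    have h4 := Nat.cast_ne_zero (R := ℝ).mpr (Nat.factorial_ne_zero k)
    field_simp
  simp only [Prod.swap]
  rw [h2]
  rcases n with _ | n <;> simp

/-- The value of `ad y / (e ^ (ad y) - 1)` at `z`, for a series `y` without constant term. -/
def formalBernoulliAd (y z : PowerSeries A) : PowerSeries A :=
  formalSum (bernoulliAdTerm y z)

theorem bernoulliAdTerm_mem_orderFil {j : ℕ} {y z : PowerSeries A} (hy : y ∈ orderFil A 1)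
    (hz : z ∈ orderFil A j) (m : ℕ) : bernoulliAdTerm y z m ∈ orderFil A (m + j) := by
  rw [bernoulliAdTerm_eq]
  exact Submodule.smul_mem _ _ (adEnd_pow_mem_orderFil hy hz m)

theorem isBernoulliAd_iff {y z c : PowerSeries A} (hy : y ∈ orderFil A 1) :
    IsBernoulliAd (orderFil A) y z c ↔ c = formalBernoulliAd y z :=
  filHasSum_iff fun m => bernoulliAdTerm_mem_orderFil hy (mem_orderFil_zero z) m

theorem formalBernoulliAd_mem_orderFil {j : ℕ} {y z : PowerSeries A} (hy : y ∈ orderFil A 1)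
    (hz : z ∈ orderFil A j) : formalBernoulliAd y z ∈ orderFil A j :=
  formalSum_mem_orderFil fun m =>
    orderFil_anti (by omega) (bernoulliAdTerm_mem_orderFil hy hz m)

theorem formalBernoulliAd_sub_mem_orderFil {N j : ℕ} {y y' z : PowerSeries A}
    (h : y - y' ∈ orderFil A N) (hy' : y' ∈ orderFil A 1) (hz : z ∈ orderFil A j) :
    formalBernoulliAd y z - formalBernoulliAd y' z ∈ orderFil A (N + j) := by
  rw [formalBernoulliAd, formalBernoulliAd, ← formalSum_sub]
  refine formalSum_mem_orderFil fun m => ?_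
  rw [bernoulliAdTerm_eq, bernoulliAdTerm_eq, ← smul_sub]
  exact Submodule.smul_mem _ _ (adEnd_pow_sub_mem_orderFil h hy' hz m)

/-- Applies `(e^{ad y} - 1) / ad y` to `(ad y / (e^{ad y} - 1))(z)`. Regrouping the double series by
powers of `ad y` leaves only the zeroth power. -/
theorem formalSum_adEnd_formalBernoulliAd {y : PowerSeries A} (hy : y ∈ orderFil A 1)
    (z : PowerSeries A) :
    (formalSum fun k => (((k + 1).factorial : ℝ)⁻¹) • (adEnd y ^ k) (formalBernoulliAd y z)) =
      z := by
  have hb := bernoulliAdTerm_mem_orderFil hy (mem_orderFil_zero z)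
  have h1 (k : ℕ) : (((k + 1).factorial : ℝ)⁻¹) • (adEnd y ^ k) (formalBernoulliAd y z) =
      formalSum fun l => ((((k + 1).factorial : ℝ)⁻¹) *
        (((bernoulli l : ℚ) : ℝ) / (l.factorial : ℝ))) • (adEnd y ^ (k + l)) z := by
    rw [formalBernoulliAd, adEnd_pow_formalSum hb hy, ← formalSum_smul]
    congr 1
    ext1 l
    rw [bernoulliAdTerm_eq, map_smul, smul_smul, pow_add, Module.End.mul_apply]
  simp only [h1]
  rw [formalSum_formalSum fun k l => Submodule.smul_mem _ _
    (adEnd_pow_mem_orderFil hy (mem_orderFil_zero z) (k + l))]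
  have h2 (n : ℕ) : ∑ p ∈ Finset.HasAntidiagonal.antidiagonal n, ((((p.1 + 1).factorial : ℝ)⁻¹) *
      (((bernoulli p.2 : ℚ) : ℝ) / (p.2.factorial : ℝ))) • (adEnd y ^ (p.1 + p.2)) z =
      if n = 0 then z else 0 := by
    rw [Finset.sum_congr rfl (g := fun p => ((((p.1 + 1).factorial : ℝ)⁻¹) *
      (((bernoulli p.2 : ℚ) : ℝ) / (p.2.factorial : ℝ))) • (adEnd y ^ n) z) fun p hp => by
        rw [Finset.HasAntidiagonal.mem_antidiagonal.mp hp], ← Finset.sum_smul, sum_antidiagonal_bernoulli]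
    split_ifs with h <;> simp [h]
  simp only [h2]
  ext n
  rw [coeff_formalSum, Finset.sum_eq_single 0 (fun m _ hm => by simp [hm])
    (fun h => absurd (Finset.mem_range.mpr n.succ_pos) h), if_pos rfl]

/-- The derivative of `exp y` along `ad y / (e ^ (ad y) - 1) (z)` is `z * exp y`. -/
theorem formalSum_powDeriv {y z : PowerSeries A} (hy : y ∈ orderFil A 1)
    (hz : z ∈ orderFil A 1) :
    (formalSum fun m => ((m.factorial : ℝ)⁻¹) • powDeriv y (formalBernoulliAd y z) m) =
      z * formalExp y := by
  set χ := formalBernoulliAd y z with hχ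
  have hχ1 : χ ∈ orderFil A 1 := formalBernoulliAd_mem_orderFil hy hz
  have hE (m : ℕ) : ((m.factorial : ℝ)⁻¹) • y ^ m ∈ orderFil A m :=
    Submodule.smul_mem _ _ (pow_mem_orderFil hy m)
  have hk (k : ℕ) : (((k + 1).factorial : ℝ)⁻¹) • (adEnd y ^ k) χ ∈ orderFil A k :=
    Submodule.smul_mem _ _ (adEnd_pow_mem_orderFil hy (mem_orderFil_zero _) k)
  have h1 : z * formalExp y = formalSum fun n => (((n + 1).factorial : ℝ)⁻¹) •
      powDeriv y χ (n + 1) := by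
    conv_lhs => rw [← formalSum_adEnd_formalBernoulliAd hy z, ← hχ, formalSum_mul hk]
    simp only [formalExp]
    simp only [mul_formalSum hE]
    rw [formalSum_formalSum fun k l => mul_mem_orderFil (hk k) (hE l)]
    congr 1
    ext1 n
    rw [powDeriv_eq_sum, Finset.smul_sum, Finset.Nat.sum_antidiagonal_eq_sum_range_succ_mk]
    refine Finset.sum_congr rfl fun k hk => ?_
    rw [Finset.mem_range] at hk
    rw [smul_mul_smul_comm, smul_smul, Nat.cast_choose ℝ (show k + 1 ≤ n + 1 by omega),
      show n + 1 - (k + 1) = n - k by omega]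
    congr 1
    have h1 := Nat.cast_ne_zero (R := ℝ).mpr (Nat.factorial_ne_zero (n + 1))
    field_simp
  rw [h1]
  ext n
  -- The two truncations differ by an index shift. The extra terms vanish: the power `y ^ 0` has
  -- derivative zero, and `powDeriv y χ (n + 1)` has order `n + 1` because `χ` has order one.
  rw [coeff_formalSum, coeff_formalSum, Finset.sum_range_succ', Finset.sum_range_succ _ n]
  congr 1
  rw [coeff_real_smul, coeff_real_smul, powDeriv_mem_orderFil hy hχ1 n n n.lt_succ_self]
  simp [powDeriv]

/-! ### Fixed points of contractions -/

/-- Banach's fixed point argument for the filtration: consecutive iterates agree to ever higher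
order, and a difference of two fixed points has every order. -/
theorem exists_fixedPoint_orderFil (T : PowerSeries A → PowerSeries A)
    (hT : ∀ f ∈ orderFil A 1, T f ∈ orderFil A 1)
    (hc : ∀ N, ∀ f ∈ orderFil A 1, ∀ g ∈ orderFil A 1, f - g ∈ orderFil A N →
      T f - T g ∈ orderFil A (N + 1))
    {c₀ : PowerSeries A} (h₀ : c₀ ∈ orderFil A 1) :
    ∃ χ ∈ orderFil A 1, (∀ ψ ∈ orderFil A 1, ψ = T ψ ↔ ψ = χ) ∧
      ∀ n, T^[n] c₀ - χ ∈ orderFil A n := by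
  have hmem (n : ℕ) : T^[n] c₀ ∈ orderFil A 1 := by
    induction n with
    | zero => exact h₀
    | succ n ih => rw [Function.iterate_succ_apply']; exact hT _ ih
  have hstep (n : ℕ) : T^[n + 1] c₀ - T^[n] c₀ ∈ orderFil A n := by
    induction n with
    | zero => exact mem_orderFil_zero _
    | succ n ih =>
      have := hc n _ (hmem (n + 1)) _ (hmem n) ih
      simpa only [← Function.iterate_succ_apply' T] using this
  have hcauchy (n k : ℕ) : T^[n + k] c₀ - T^[n] c₀ ∈ orderFil A n := by
    induction k with
    | zero => simp
    | succ k ih =>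
      have := Submodule.add_mem _ (orderFil_anti (show n ≤ n + k by omega) (hstep (n + k))) ih
      simpa [add_assoc] using this
  -- The coefficient of degree `n` is stationary from iterate `n + 1` on.
  set χ : PowerSeries A := PowerSeries.mk fun n => PowerSeries.coeff n (T^[n + 1] c₀) with hχ
  have hlim (n : ℕ) : T^[n] c₀ - χ ∈ orderFil A n := by
    intro k hk
    have h := hcauchy (k + 1) (n - (k + 1)) k k.lt_succ_self
    rw [show k + 1 + (n - (k + 1)) = n by omega, map_sub] at h
    rw [map_sub, hχ, PowerSeries.coeff_mk, h]
  have hχ1 : χ ∈ orderFil A 1 := by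
    have := Submodule.sub_mem _ (hmem 1) (hlim 1)
    simpa using this
  have hfix : χ = T χ := by
    refine eq_of_forall_sub_mem_orderFil fun N => ?_
    have h1 := hc N _ (hmem N) _ hχ1 (hlim N)
    have h2 := hlim (N + 1)
    rw [Function.iterate_succ_apply'] at h2
    have := Submodule.sub_mem _ h1 h2
    simpa using orderFil_anti N.le_succ this
  refine ⟨χ, hχ1, fun ψ hψ => ⟨fun h => ?_, fun h => by rw [h]; exact hfix⟩, hlim⟩
  refine eq_of_forall_sub_mem_orderFil fun N => ?_
  induction N with
  | zero => exact mem_orderFil_zero _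
  | succ N ih =>
    have := hc N _ hψ _ hχ1 ih
    rwa [← h, ← hfix] at this

end Formal

/-! ### The formal Magnus expansion -/

section Magnus

variable {B : Type*} [NormedRing B] [NormedAlgebra ℝ B] [CompleteSpace B]

theorem riemann_apply (f : C(ℝ, B)) (t : ℝ) : riemann f t = ∫ s in (0 : ℝ)..t, f s := rfl

theorem coeff_riemannSeries (n : ℕ) (f : PowerSeries C(ℝ, B)) :
    PowerSeries.coeff n (riemannSeries f) = riemann (PowerSeries.coeff n f) :=
  PowerSeries.coeff_mk n fun n => riemann (PowerSeries.coeff n f)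

theorem riemannSeries_mem_orderFil {N : ℕ} {f : PowerSeries C(ℝ, B)}
    (hf : f ∈ orderFil C(ℝ, B) N) : riemannSeries f ∈ orderFil C(ℝ, B) N := by
  intro k hk
  rw [coeff_riemannSeries, hf k hk, map_zero]

theorem seriesInitial_riemannSeries (f : PowerSeries C(ℝ, B)) :
    SeriesInitial (riemannSeries f) 0 := by
  intro n
  rw [coeff_riemannSeries, riemann_apply, intervalIntegral.integral_same, map_zero]

theorem hasDerivAt_riemann (f : C(ℝ, B)) (t : ℝ) :
    HasDerivAt (fun s => riemann f s) (f t) t :=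
  (f.continuous.integral_hasStrictDerivAt 0 t).hasDerivAt

theorem hasSeriesDeriv_riemannSeries (f : PowerSeries C(ℝ, B)) :
    HasSeriesDeriv (riemannSeries f) f := by
  intro n t
  rw [coeff_riemannSeries]
  exact hasDerivAt_riemann _ t

theorem riemann_eq_sub_of_hasDerivAt {g : ℝ → B} {f : C(ℝ, B)}
    (h : ∀ t, HasDerivAt g (f t) t) (t : ℝ) : riemann f t = g t - g 0 :=
  intervalIntegral.integral_eq_sub_of_hasDerivAt (fun s _ => h s)
    (f.continuous.intervalIntegrable _ _)

theorem HasSeriesDeriv.coeff_eq {G H : PowerSeries C(ℝ, B)} (h : HasSeriesDeriv G H) (n : ℕ)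
    (t : ℝ) : PowerSeries.coeff n G t =
      PowerSeries.coeff n G 0 + riemann (PowerSeries.coeff n H) t := by
  rw [riemann_eq_sub_of_hasDerivAt (h n) t, add_sub_cancel]

theorem HasSeriesDeriv.eq_riemannSeries {G H : PowerSeries C(ℝ, B)} (h : HasSeriesDeriv G H)
    (h0 : SeriesInitial G 0) : G = riemannSeries H := by
  ext n t
  rw [h.coeff_eq, h0 n, coeff_riemannSeries, map_zero, zero_add]

theorem HasSeriesDeriv.mul {G H G' H' : PowerSeries C(ℝ, B)} (h : HasSeriesDeriv G H)
    (h' : HasSeriesDeriv G' H') : HasSeriesDeriv (G * G') (H * G' + G * H') := by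
  intro n t
  have := HasDerivAt.fun_sum (u := Finset.HasAntidiagonal.antidiagonal n)
    fun p (_ : p ∈ Finset.HasAntidiagonal.antidiagonal n) => (h p.1 t).mul (h' p.2 t)
  simpa [PowerSeries.coeff_mul, ContinuousMap.sum_apply, Finset.sum_add_distrib] using this

theorem HasSeriesDeriv.pow {G H : PowerSeries C(ℝ, B)} (h : HasSeriesDeriv G H) (n : ℕ) :
    HasSeriesDeriv (G ^ n) (powDeriv G H n) := by
  induction n with
  | zero =>
    intro k t
    rw [pow_zero, powDeriv, PowerSeries.coeff_one]
    split_ifs <;> exact hasDerivAt_const t _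
  | succ n ih => rw [pow_succ]; exact ih.mul h

theorem HasSeriesDeriv.real_smul {G H : PowerSeries C(ℝ, B)} (h : HasSeriesDeriv G H) (r : ℝ) :
    HasSeriesDeriv (r • G) (r • H) := fun n t => (h n t).const_smul r

/-- Every coefficient of a `formalSum` is a finite sum, so termwise differentiation needs no
convergence argument. -/
theorem HasSeriesDeriv.formalSum {u v : ℕ → PowerSeries C(ℝ, B)}
    (h : ∀ m, HasSeriesDeriv (u m) (v m)) :
    HasSeriesDeriv (formalSum u) (formalSum v) := by
  intro n t
  have := HasDerivAt.fun_sum (u := Finset.range (n + 1)) fun m (_ : m ∈ _) => h m n t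
  simpa [coeff_formalSum, ContinuousMap.sum_apply] using this

theorem coeff_zero_monomial_one_mul {A : Type*} [Ring A] [Algebra ℝ A] (a : A) (F : PowerSeries A) :
    PowerSeries.coeff 0 (PowerSeries.monomial 1 a * F) = 0 :=
  mul_mem_orderFil (monomial_mem_orderFil a) (mem_orderFil_zero F) 0 one_pos

theorem coeff_succ_monomial_one_mul {A : Type*} [Ring A] (a : A) (F : PowerSeries A) (n : ℕ) :
    PowerSeries.coeff (n + 1) (PowerSeries.monomial 1 a * F) = a * PowerSeries.coeff n F := by
  rw [PowerSeries.coeff_mul, Finset.sum_eq_single (1, n)]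
  · simp
  · rintro ⟨i, j⟩ hp hne
    rw [Finset.HasAntidiagonal.mem_antidiagonal] at hp
    rw [PowerSeries.coeff_monomial, if_neg, zero_mul]
    rintro rfl
    exact hne (by simp only [Prod.mk.injEq, true_and]; simp only at hp; omega)
  · intro h
    exact absurd (Finset.HasAntidiagonal.mem_antidiagonal.mpr (add_comm 1 n)) h

/-- The factor `X` shifts degrees, so each coefficient is its initial value plus the integral of `a`
times the preceding one. -/
theorem eq_of_hasSeriesDeriv_monomial_mul {a : C(ℝ, B)} {F G : PowerSeries C(ℝ, B)}
    {b : PowerSeries B} (hF0 : SeriesInitial F b) (hG0 : SeriesInitial G b)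
    (hF : HasSeriesDeriv F (PowerSeries.monomial 1 a * F))
    (hG : HasSeriesDeriv G (PowerSeries.monomial 1 a * G)) : F = G := by
  ext1 n
  induction n with
  | zero =>
    ext t
    rw [hF.coeff_eq, hG.coeff_eq, hF0, hG0, coeff_zero_monomial_one_mul,
      coeff_zero_monomial_one_mul]
  | succ n ih =>
    ext t
    rw [hF.coeff_eq, hG.coeff_eq, hF0, hG0, coeff_succ_monomial_one_mul,
      coeff_succ_monomial_one_mul, ih]

theorem seriesInitial_formalExp {Ω : PowerSeries C(ℝ, B)} (h : SeriesInitial Ω 0) :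
    SeriesInitial (formalExp Ω) 1 := by
  intro n
  have hpow (m k : ℕ) : PowerSeries.coeff k (Ω ^ (m + 1)) 0 = 0 := by
    rw [pow_succ, PowerSeries.coeff_mul, ContinuousMap.sum_apply]
    refine Finset.sum_eq_zero fun p _ => ?_
    rw [ContinuousMap.mul_apply, h p.2,
      map_zero (PowerSeries.coeff (R := B) p.2), mul_zero]
  rw [formalExp, coeff_formalSum, ContinuousMap.sum_apply,
    Finset.sum_eq_single 0 ?_ (fun h => absurd (Finset.mem_range.mpr n.succ_pos) h)]
  · rw [coeff_real_smul, pow_zero, PowerSeries.coeff_one, PowerSeries.coeff_one]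
    split_ifs <;> simp
  · intro m _ hm
    obtain ⟨m, rfl⟩ := Nat.exists_eq_succ_of_ne_zero hm
    rw [coeff_real_smul, ContinuousMap.smul_apply, hpow, smul_zero]

/-- The right-hand side of the weight-zero CBHD recursion. -/
def zeroCBHDStep (a : C(ℝ, B)) (ψ : PowerSeries C(ℝ, B)) : PowerSeries C(ℝ, B) :=
  formalBernoulliAd (riemannSeries ψ) (PowerSeries.monomial 1 a)

theorem zeroCBHDStep_mem (a : C(ℝ, B)) {ψ : PowerSeries C(ℝ, B)} (h : ψ ∈ orderFil C(ℝ, B) 1) :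
    zeroCBHDStep a ψ ∈ orderFil C(ℝ, B) 1 :=
  formalBernoulliAd_mem_orderFil (riemannSeries_mem_orderFil h) (monomial_mem_orderFil a)

theorem exists_zeroCBHDStep_fixedPoint (a : C(ℝ, B)) :
    ∃ χ ∈ orderFil C(ℝ, B) 1, (∀ ψ ∈ orderFil C(ℝ, B) 1, ψ = zeroCBHDStep a ψ ↔ ψ = χ) ∧
      ∀ n, (zeroCBHDStep a)^[n] (PowerSeries.monomial 1 a) - χ ∈ orderFil C(ℝ, B) n := by
  refine exists_fixedPoint_orderFil (zeroCBHDStep a) (fun f hf => zeroCBHDStep_mem a hf)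
    (fun N f _ g hg h => ?_) (monomial_mem_orderFil a)
  refine formalBernoulliAd_sub_mem_orderFil ?_ (riemannSeries_mem_orderFil hg)
    (monomial_mem_orderFil a)
  rw [← map_sub]
  exact riemannSeries_mem_orderFil h

theorem isZeroCBHD_iff {a : C(ℝ, B)} {ψ : PowerSeries C(ℝ, B)} :
    IsZeroCBHD (orderFil C(ℝ, B)) riemannSeries (PowerSeries.monomial 1 a) ψ ↔
      ψ ∈ orderFil C(ℝ, B) 1 ∧ ψ = zeroCBHDStep a ψ :=
  and_congr_right fun h => isBernoulliAd_iff (riemannSeries_mem_orderFil h)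

theorem isZeroCBHDIteration_iterate (a : C(ℝ, B)) :
    IsZeroCBHDIteration (orderFil C(ℝ, B)) riemannSeries (PowerSeries.monomial 1 a)
      fun n => (zeroCBHDStep a)^[n] (PowerSeries.monomial 1 a) := by
  have hmem (n : ℕ) : (zeroCBHDStep a)^[n] (PowerSeries.monomial 1 a) ∈ orderFil C(ℝ, B) 1 := by
    induction n with
    | zero => exact monomial_mem_orderFil a
    | succ n ih => rw [Function.iterate_succ_apply']; exact zeroCBHDStep_mem a ih
  refine ⟨rfl, fun n => ?_⟩
  rw [isBernoulliAd_iff (riemannSeries_mem_orderFil (hmem n))]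
  exact Function.iterate_succ_apply' _ _ _

theorem hasSeriesDeriv_formalExp_riemannSeries {a : C(ℝ, B)} {χ : PowerSeries C(ℝ, B)}
    (hχ : χ ∈ orderFil C(ℝ, B) 1) (hfix : χ = zeroCBHDStep a χ) :
    HasSeriesDeriv (formalExp (riemannSeries χ))
      (PowerSeries.monomial 1 a * formalExp (riemannSeries χ)) := by
  rw [← formalSum_powDeriv (riemannSeries_mem_orderFil hχ) (monomial_mem_orderFil a)]
  refine HasSeriesDeriv.formalSum fun m => HasSeriesDeriv.real_smul (HasSeriesDeriv.pow ?_ m) _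
  have := hasSeriesDeriv_riemannSeries χ
  nth_rewrite 2 [hfix] at this
  exact this

theorem isMagnusExponent_iff {a : C(ℝ, B)} {χ : PowerSeries C(ℝ, B)}
    (hχ : χ ∈ orderFil C(ℝ, B) 1) (hfix : χ = zeroCBHDStep a χ) (Ω : PowerSeries C(ℝ, B)) :
    IsMagnusExponent a Ω ↔ Ω = riemannSeries χ := by
  have hR := riemannSeries_mem_orderFil hχ
  have hR0 := seriesInitial_formalExp (seriesInitial_riemannSeries χ)
  have hRd := hasSeriesDeriv_formalExp_riemannSeries hχ hfix
  constructor
  · rintro ⟨hΩ, -, F, hexp, hF0, hF⟩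
    rw [isFilExp_iff hΩ] at hexp
    exact formalExp_injOn hΩ hR
      (hexp ▸ eq_of_hasSeriesDeriv_monomial_mul hF0 hR0 hF hRd)
  · rintro rfl
    exact ⟨hR, seriesInitial_riemannSeries χ, _, (isFilExp_iff hR).mpr rfl, hR0, hRd⟩

theorem solvesMagnusODE_iff {a : C(ℝ, B)} {χ : PowerSeries C(ℝ, B)}
    (hχ : χ ∈ orderFil C(ℝ, B) 1) (hfix : χ = zeroCBHDStep a χ)
    (huniq : ∀ ψ ∈ orderFil C(ℝ, B) 1, ψ = zeroCBHDStep a ψ ↔ ψ = χ)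
    (Ω : PowerSeries C(ℝ, B)) : SolvesMagnusODE a Ω ↔ Ω = riemannSeries χ := by
  constructor
  · rintro ⟨hΩ, hΩ0, D, hD, hderiv⟩
    rw [isBernoulliAd_iff hΩ] at hD
    have hD1 : D ∈ orderFil C(ℝ, B) 1 :=
      hD ▸ formalBernoulliAd_mem_orderFil hΩ (monomial_mem_orderFil a)
    have hΩD := hderiv.eq_riemannSeries hΩ0
    -- The derivative `D` of a solution satisfies the CBHD recursion, because `Ω = R D`.
    rw [hΩD, (huniq D hD1).mp (by rw [zeroCBHDStep, ← hΩD]; exact hD)]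
  · rintro rfl
    exact ⟨riemannSeries_mem_orderFil hχ, seriesInitial_riemannSeries χ, χ,
      (isBernoulliAd_iff (riemannSeries_mem_orderFil hχ)).mpr hfix,
      hasSeriesDeriv_riemannSeries χ⟩

end Magnus

/-! ### Evaluation of formal series in a Banach algebra -/

open scoped ENNReal NNReal

section Evaluation

variable {A : Type*} [Ring A] [Algebra ℝ A] {D : Type*} [NormedRing D] [NormedAlgebra ℝ D]
  (ρ : A →ₐ[ℝ] D) (r : ℝ)

/-- The `n`-th term of the series `f` at the parameter `r`, mapped to `D`. -/
def mappedTerm (f : PowerSeries A) (n : ℕ) : D := r ^ n • ρ (PowerSeries.coeff n f)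

/-- The `ℓ¹`-norm of the terms of `f` at the parameter `r`, mapped to `D`. -/
def seriesNorm (f : PowerSeries A) : ℝ≥0∞ := ∑' n, ‖mappedTerm ρ r f n‖ₑ

/-- The sum of the series `f` at the parameter `r`, mapped to `D`. -/
def seriesEval (f : PowerSeries A) : D := ∑' n, mappedTerm ρ r f n

theorem mappedTerm_sub (f g : PowerSeries A) (n : ℕ) :
    mappedTerm ρ r (f - g) n = mappedTerm ρ r f n - mappedTerm ρ r g n := by
  simp [mappedTerm, smul_sub]

theorem mappedTerm_smul (c : ℝ) (f : PowerSeries A) (n : ℕ) :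
    mappedTerm ρ r (c • f) n = c • mappedTerm ρ r f n := by
  rw [mappedTerm, coeff_real_smul, map_smul, smul_comm, mappedTerm]

theorem mappedTerm_mul (f g : PowerSeries A) (n : ℕ) :
    mappedTerm ρ r (f * g) n = ∑ p ∈ Finset.HasAntidiagonal.antidiagonal n,
      mappedTerm ρ r f p.1 * mappedTerm ρ r g p.2 := by
  rw [mappedTerm, PowerSeries.coeff_mul, map_sum, Finset.smul_sum]
  refine Finset.sum_congr rfl fun p hp => ?_
  rw [mappedTerm, mappedTerm, smul_mul_smul_comm, ← pow_add,
    Finset.HasAntidiagonal.mem_antidiagonal.mp hp, map_mul]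

theorem enorm_mul_le_mul (x y : D) : ‖x * y‖ₑ ≤ ‖x‖ₑ * ‖y‖ₑ := by
  simp only [enorm_eq_nnnorm, ← ENNReal.coe_mul, ENNReal.coe_le_coe]
  exact nnnorm_mul_le x y

theorem summable_norm_of_tsum_enorm {E ι : Type*} [NormedAddCommGroup E] {f : ι → E}
    (h : ∑' i, ‖f i‖ₑ ≠ ∞) : Summable fun i => ‖f i‖ :=
  NNReal.summable_coe.mpr (ENNReal.tsum_coe_ne_top_iff_summable.mp h)

theorem seriesNorm_sub_le (f g : PowerSeries A) :
    seriesNorm ρ r (f - g) ≤ seriesNorm ρ r f + seriesNorm ρ r g := by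
  rw [seriesNorm, seriesNorm, seriesNorm, ← ENNReal.tsum_add]
  refine ENNReal.tsum_le_tsum fun n => ?_
  rw [mappedTerm_sub]
  exact enorm_sub_le

theorem seriesNorm_smul (c : ℝ) (f : PowerSeries A) :
    seriesNorm ρ r (c • f) = ‖c‖ₑ * seriesNorm ρ r f := by
  simp only [seriesNorm, mappedTerm_smul, enorm_smul, ENNReal.tsum_mul_left]

/-- Values in `ℝ≥0∞` allow the Cauchy product to be rearranged before any summability is known. -/
theorem seriesNorm_mul_le (f g : PowerSeries A) :
    seriesNorm ρ r (f * g) ≤ seriesNorm ρ r f * seriesNorm ρ r g := by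
  calc seriesNorm ρ r (f * g)
      ≤ ∑' n, ∑ p ∈ Finset.HasAntidiagonal.antidiagonal n,
          ‖mappedTerm ρ r f p.1‖ₑ * ‖mappedTerm ρ r g p.2‖ₑ := by
        refine ENNReal.tsum_le_tsum fun n => ?_
        rw [mappedTerm_mul]
        exact (enorm_sum_le _ _).trans (Finset.sum_le_sum fun p _ => enorm_mul_le_mul _ _)
    _ = ∑' p : ℕ × ℕ, ‖mappedTerm ρ r f p.1‖ₑ * ‖mappedTerm ρ r g p.2‖ₑ := by
        rw [← Finset.HasAntidiagonal.sigmaAntidiagonalEquivProd.tsum_eq, ENNReal.tsum_sigma']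
        refine tsum_congr fun n => ?_
        rw [tsum_fintype]
        exact (Finset.sum_coe_sort _
          fun p : ℕ × ℕ => ‖mappedTerm ρ r f p.1‖ₑ * ‖mappedTerm ρ r g p.2‖ₑ).symm
    _ = seriesNorm ρ r f * seriesNorm ρ r g := by
        rw [ENNReal.tsum_prod (f := fun i j => ‖mappedTerm ρ r f i‖ₑ * ‖mappedTerm ρ r g j‖ₑ)]
        simp only [ENNReal.tsum_mul_left, ENNReal.tsum_mul_right]
        rfl

theorem seriesNorm_adEnd_le (y z : PowerSeries A) :
    seriesNorm ρ r (adEnd y z) ≤ 2 * seriesNorm ρ r y * seriesNorm ρ r z := by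
  rw [adEnd_apply]
  refine (seriesNorm_sub_le ρ r _ _).trans ?_
  refine (add_le_add (seriesNorm_mul_le ρ r y z) (seriesNorm_mul_le ρ r z y)).trans ?_
  rw [mul_comm (seriesNorm ρ r z), two_mul, add_mul]

theorem seriesNorm_adEnd_pow_le (y z : PowerSeries A) (m : ℕ) :
    seriesNorm ρ r ((adEnd y ^ m) z) ≤ (2 * seriesNorm ρ r y) ^ m * seriesNorm ρ r z := by
  induction m with
  | zero => simp
  | succ m ih =>
    rw [pow_succ', Module.End.mul_apply]
    refine (seriesNorm_adEnd_le ρ r _ _).trans ?_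
    rw [pow_succ', mul_assoc (2 * seriesNorm ρ r y)]
    exact mul_le_mul_right ih _

theorem seriesNorm_one_le : seriesNorm ρ r 1 ≤ ‖(1 : D)‖ₑ := by
  rw [seriesNorm, tsum_eq_single 0]
  · simp [mappedTerm]
  · intro n hn
    simp [mappedTerm, PowerSeries.coeff_one, hn]

/-- The factor `‖1‖` stays because the unit of `D` is not assumed to have norm one. -/
theorem seriesNorm_pow_le (y : PowerSeries A) (m : ℕ) :
    seriesNorm ρ r (y ^ m) ≤ ‖(1 : D)‖ₑ * seriesNorm ρ r y ^ m := by
  induction m with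
  | zero => simpa using seriesNorm_one_le ρ r
  | succ m ih =>
    rw [pow_succ, pow_succ, ← mul_assoc]
    exact (seriesNorm_mul_le ρ r _ _).trans (by gcongr)

theorem seriesNorm_monomial (a : A) :
    seriesNorm ρ r (PowerSeries.monomial 1 a) = ‖r • ρ a‖ₑ := by
  rw [seriesNorm, tsum_eq_single 1]
  · simp [mappedTerm]
  · intro n hn
    simp [mappedTerm, PowerSeries.coeff_monomial, hn]

theorem seriesEval_monomial (a : A) :
    seriesEval ρ r (PowerSeries.monomial 1 a) = r • ρ a := by
  rw [seriesEval, tsum_eq_single 1]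
  · simp [mappedTerm]
  · intro n hn
    simp [mappedTerm, PowerSeries.coeff_monomial, hn]

theorem seriesEval_one : seriesEval ρ r 1 = 1 := by
  rw [seriesEval, tsum_eq_single 0]
  · simp [mappedTerm]
  · intro n hn
    simp [mappedTerm, PowerSeries.coeff_one, hn]

theorem seriesNorm_formalSum_le (u : ℕ → PowerSeries A) :
    seriesNorm ρ r (formalSum u) ≤ ∑' m, seriesNorm ρ r (u m) := by
  simp only [seriesNorm]
  rw [ENNReal.tsum_comm]
  refine ENNReal.tsum_le_tsum fun n => ?_
  rw [mappedTerm, coeff_formalSum, map_sum, Finset.smul_sum]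
  exact (enorm_sum_le _ _).trans (ENNReal.sum_le_tsum _)

variable {ρ r}

theorem summable_norm_mappedTerm {f : PowerSeries A} (h : seriesNorm ρ r f ≠ ∞) :
    Summable fun n => ‖mappedTerm ρ r f n‖ :=
  summable_norm_of_tsum_enorm h

variable [CompleteSpace D]

theorem hasSum_seriesEval {f : PowerSeries A} (h : seriesNorm ρ r f ≠ ∞) :
    HasSum (mappedTerm ρ r f) (seriesEval ρ r f) :=
  (summable_norm_mappedTerm h).of_norm.hasSum

theorem seriesEval_sub {f g : PowerSeries A} (hf : seriesNorm ρ r f ≠ ∞)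
    (hg : seriesNorm ρ r g ≠ ∞) :
    seriesEval ρ r (f - g) = seriesEval ρ r f - seriesEval ρ r g := by
  rw [seriesEval, ← ((hasSum_seriesEval hf).sub (hasSum_seriesEval hg)).tsum_eq]
  exact tsum_congr fun n => mappedTerm_sub ρ r f g n

theorem seriesEval_smul (c : ℝ) {f : PowerSeries A} (hf : seriesNorm ρ r f ≠ ∞) :
    seriesEval ρ r (c • f) = c • seriesEval ρ r f := by
  rw [seriesEval, ← ((hasSum_seriesEval hf).const_smul c).tsum_eq]
  exact tsum_congr fun n => mappedTerm_smul ρ r c f n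

theorem seriesEval_mul {f g : PowerSeries A} (hf : seriesNorm ρ r f ≠ ∞)
    (hg : seriesNorm ρ r g ≠ ∞) :
    seriesEval ρ r (f * g) = seriesEval ρ r f * seriesEval ρ r g := by
  rw [seriesEval, seriesEval, seriesEval, tsum_mul_tsum_eq_tsum_sum_antidiagonal_of_summable_norm
    (summable_norm_mappedTerm hf) (summable_norm_mappedTerm hg)]
  exact tsum_congr fun n => mappedTerm_mul ρ r f g n

theorem seriesNorm_adEnd_pow_ne_top {y z : PowerSeries A} (hy : seriesNorm ρ r y ≠ ∞)
    (hz : seriesNorm ρ r z ≠ ∞) (m : ℕ) : seriesNorm ρ r ((adEnd y ^ m) z) ≠ ∞ :=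
  ne_top_of_le_ne_top (ENNReal.mul_ne_top
    (ENNReal.pow_ne_top (ENNReal.mul_ne_top ENNReal.ofNat_ne_top hy)) hz)
    (seriesNorm_adEnd_pow_le ρ r y z m)

theorem seriesEval_adEnd_pow {y z : PowerSeries A} (hy : seriesNorm ρ r y ≠ ∞)
    (hz : seriesNorm ρ r z ≠ ∞) (m : ℕ) :
    seriesEval ρ r ((adEnd y ^ m) z) = (adEnd (seriesEval ρ r y) ^ m) (seriesEval ρ r z) := by
  induction m with
  | zero => simp
  | succ m ih =>
    have hm := seriesNorm_adEnd_pow_ne_top hy hz m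
    have h1 := ne_top_of_le_ne_top (ENNReal.mul_ne_top hy hm) (seriesNorm_mul_le ρ r _ _)
    have h2 := ne_top_of_le_ne_top (ENNReal.mul_ne_top hm hy) (seriesNorm_mul_le ρ r _ _)
    rw [pow_succ', Module.End.mul_apply, adEnd_apply, seriesEval_sub h1 h2,
      seriesEval_mul hy hm, seriesEval_mul hm hy, ih, pow_succ', Module.End.mul_apply,
      adEnd_apply]

theorem seriesNorm_pow_ne_top {y : PowerSeries A} (hy : seriesNorm ρ r y ≠ ∞) (m : ℕ) :
    seriesNorm ρ r (y ^ m) ≠ ∞ :=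
  ne_top_of_le_ne_top (ENNReal.mul_ne_top enorm_ne_top (ENNReal.pow_ne_top hy))
    (seriesNorm_pow_le ρ r y m)

theorem seriesEval_pow {y : PowerSeries A} (hy : seriesNorm ρ r y ≠ ∞) (m : ℕ) :
    seriesEval ρ r (y ^ m) = seriesEval ρ r y ^ m := by
  induction m with
  | zero => simp [seriesEval_one]
  | succ m ih => rw [pow_succ, seriesEval_mul (seriesNorm_pow_ne_top hy m) hy, ih, pow_succ]

/-- Fubini for the absolutely summable double family of terms. Summing over `m` at fixed degree is a
finite sum, which is the coefficient of `formalSum u`. -/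
theorem hasSum_seriesEval_formalSum {u : ℕ → PowerSeries A} (hu : ∀ m, u m ∈ orderFil A m)
    (h : ∑' m, seriesNorm ρ r (u m) ≠ ∞) :
    HasSum (fun m => seriesEval ρ r (u m)) (seriesEval ρ r (formalSum u)) := by
  have hs : Summable fun p : ℕ × ℕ => mappedTerm ρ r (u p.1) p.2 := by
    have hp : ∑' p : ℕ × ℕ, ‖mappedTerm ρ r (u p.1) p.2‖ₑ ≠ ∞ := by
      rw [ENNReal.tsum_prod' (f := fun p : ℕ × ℕ => ‖mappedTerm ρ r (u p.1) p.2‖ₑ)]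
      exact h
    exact (summable_norm_of_tsum_enorm hp).of_norm
  have hm (m : ℕ) : seriesNorm ρ r (u m) ≠ ∞ :=
    ENNReal.ne_top_of_tsum_ne_top (f := fun m => seriesNorm ρ r (u m)) h m
  have h1 : HasSum (fun m => seriesEval ρ r (u m))
      (∑' p : ℕ × ℕ, mappedTerm ρ r (u p.1) p.2) := by
    refine hs.hasSum.prod_fiberwise fun m => ?_
    change HasSum (mappedTerm ρ r (u m)) _
    exact hasSum_seriesEval (hm m)
  have h2 : HasSum (fun n => mappedTerm ρ r (formalSum u) n)
      (∑' p : ℕ × ℕ, mappedTerm ρ r (u p.1) p.2) := by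
    have hswap : HasSum (fun p : ℕ × ℕ => mappedTerm ρ r (u p.2) p.1)
        (∑' p : ℕ × ℕ, mappedTerm ρ r (u p.1) p.2) :=
      (Equiv.hasSum_iff (f := fun p : ℕ × ℕ => mappedTerm ρ r (u p.1) p.2)
        (Equiv.prodComm ℕ ℕ)).mpr hs.hasSum
    refine hswap.prod_fiberwise fun n => ?_
    change HasSum (fun m => mappedTerm ρ r (u m) n) _
    rw [mappedTerm, coeff_formalSum, map_sum, Finset.smul_sum]
    refine hasSum_sum_of_ne_finset_zero fun m hm => ?_
    rw [mappedTerm, hu m n (by simpa using hm), map_zero, smul_zero]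
  have h3 : seriesEval ρ r (formalSum u) = ∑' p : ℕ × ℕ, mappedTerm ρ r (u p.1) p.2 := h2.tsum_eq
  rw [h3]
  exact h1

/-- The terms are dominated by those of `‖1‖ e^c`, where `c` is the norm of `y`. No smallness of `y`
is needed, which the Abel argument relies on. -/
theorem seriesEval_formalExp {y : PowerSeries A} (hy1 : y ∈ orderFil A 1)
    (hy : seriesNorm ρ r y ≠ ∞) :
    seriesEval ρ r (formalExp y) = NormedSpace.exp (seriesEval ρ r y) := by
  have hsum : ∑' m : ℕ, seriesNorm ρ r (((m.factorial : ℝ)⁻¹) • y ^ m) ≠ ∞ := by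
    obtain ⟨c, hc⟩ := WithTop.ne_top_iff_exists.mp hy
    change (c : ℝ≥0∞) = _ at hc
    have hs : Summable fun m : ℕ => ‖(1 : D)‖ * ((c : ℝ) ^ m / m.factorial) :=
      (Real.summable_pow_div_factorial c).mul_left _
    refine ne_top_of_le_ne_top hs.tsum_ofReal_ne_top (ENNReal.tsum_le_tsum fun m => ?_)
    rw [seriesNorm_smul]
    refine (mul_le_mul_right (seriesNorm_pow_le ρ r y m) _).trans (le_of_eq ?_)
    rw [← hc, Real.enorm_eq_ofReal (by positivity), ENNReal.ofReal_mul (by positivity),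
      ofReal_norm, div_eq_mul_inv, ENNReal.ofReal_mul (by positivity),
      ENNReal.ofReal_pow (by positivity), ENNReal.ofReal_coe_nnreal]
    ring
  have h1 := hasSum_seriesEval_formalSum
    (fun m => Submodule.smul_mem _ _ (pow_mem_orderFil hy1 m)) hsum
  have h2 := NormedSpace.exp_series_hasSum_exp' (𝕂 := ℝ) (seriesEval ρ r y)
  refine h1.unique ?_
  convert h2 using 2 with m
  rw [seriesEval_smul _ (seriesNorm_pow_ne_top hy m), seriesEval_pow hy]

/-! ### Bounds for Bernoulli numbers and for the Bernoulli series of `ad y` -/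

theorem sum_inv_factorial_le_one (n : ℕ) :
    ∑ k ∈ Finset.range n, ((n - k + 1).factorial : ℝ)⁻¹ ≤ 1 := by
  have h : ∀ n : ℕ, ∑ k ∈ Finset.range n, ((n - k + 1).factorial : ℝ)⁻¹ ≤ 1 - (1 / 2) ^ n := by
    intro n
    rw [← Finset.sum_range_reflect]
    have h1 : ∑ k ∈ Finset.range n, ((n - (n - 1 - k) + 1).factorial : ℝ)⁻¹ ≤
        ∑ k ∈ Finset.range n, (1 / 2 : ℝ) * (1 / 2) ^ k := by
      refine Finset.sum_le_sum fun k hk => ?_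
      rw [Finset.mem_range] at hk
      rw [show n - (n - 1 - k) + 1 = k + 2 by omega, ← pow_succ', one_div, inv_pow]
      refine inv_anti₀ (by positivity) ?_
      -- After reflection the summand is `1 / (k + 2)!`, and `(k + 2)! ≥ 2 ^ (k + 1)` gives a
      -- geometric majorant.
      have := Nat.factorial_mul_pow_le_factorial (m := 1) (n := k + 1)
      rw [add_comm 1 (k + 1), Nat.factorial_one, one_mul, one_add_one_eq_two] at this
      exact_mod_cast this
    refine h1.trans (le_of_eq ?_)
    rw [← Finset.mul_sum, geom_sum_eq (by norm_num)]
    ring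
  exact (h n).trans (by linarith [pow_pos (one_half_pos (α := ℝ)) n])

/-- Strong induction on the Bernoulli recursion. The crude bound suffices: it dominates the
Bernoulli series by a geometric one. -/
theorem abs_bernoulli_div_factorial_le_one (n : ℕ) :
    |((bernoulli n : ℚ) : ℝ) / (n.factorial : ℝ)| ≤ 1 := by
  induction n using Nat.strong_induction_on with
  | _ n ih =>
    rcases Nat.eq_zero_or_pos n with rfl | hn
    · simp
    have h := sum_antidiagonal_bernoulli n
    rw [if_neg hn.ne', ← Finset.Nat.sum_antidiagonal_swap,
      Finset.Nat.sum_antidiagonal_eq_sum_range_succ_mk, Finset.sum_range_succ] at h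
    simp only [Prod.swap, Nat.sub_self, zero_add, Nat.factorial_one, Nat.cast_one, inv_one,
      one_mul] at h
    rw [eq_neg_of_add_eq_zero_right h, abs_neg]
    refine (Finset.abs_sum_le_sum_abs _ _).trans
      ((Finset.sum_le_sum fun k hk => ?_).trans (sum_inv_factorial_le_one n))
    rw [abs_mul, abs_of_nonneg (by positivity : (0 : ℝ) ≤ ((n - k + 1).factorial : ℝ)⁻¹)]
    exact mul_le_of_le_one_right (by positivity) (ih k (Finset.mem_range.mp hk))

/-- The constant `4⁻¹` makes `ad y`, of norm at most twice that of `y`, contract by one half. -/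
theorem seriesNorm_bernoulliAdTerm_le {y : PowerSeries A} (hy : seriesNorm ρ r y ≤ 4⁻¹)
    (z : PowerSeries A) (m : ℕ) :
    seriesNorm ρ r (bernoulliAdTerm y z m) ≤ 2⁻¹ ^ m * seriesNorm ρ r z := by
  rw [bernoulliAdTerm_eq, seriesNorm_smul]
  have h1 : ‖((bernoulli m : ℚ) : ℝ) / (m.factorial : ℝ)‖ₑ ≤ 1 := by
    rw [← ofReal_norm, ENNReal.ofReal_le_one]
    exact abs_bernoulli_div_factorial_le_one m
  have h2 : 2 * seriesNorm ρ r y ≤ 2⁻¹ := by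
    refine (mul_le_mul_right hy 2).trans (le_of_eq ?_)
    rw [show (4 : ℝ≥0∞) = 2 * 2 by norm_num, ENNReal.mul_inv (by simp) (by simp), ← mul_assoc,
      ENNReal.mul_inv_cancel (by simp) (by simp), one_mul]
  refine (mul_le_mul' h1 (seriesNorm_adEnd_pow_le ρ r y z m)).trans ?_
  rw [one_mul]
  gcongr

theorem tsum_seriesNorm_bernoulliAdTerm_le {y : PowerSeries A} (hy : seriesNorm ρ r y ≤ 4⁻¹)
    (z : PowerSeries A) :
    ∑' m, seriesNorm ρ r (bernoulliAdTerm y z m) ≤ 2 * seriesNorm ρ r z := by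
  refine (ENNReal.tsum_le_tsum fun m => seriesNorm_bernoulliAdTerm_le hy z m).trans
    (le_of_eq ?_)
  rw [ENNReal.tsum_mul_right, ENNReal.tsum_geometric, ENNReal.one_sub_inv_two, inv_inv]

theorem seriesNorm_formalBernoulliAd_le {y : PowerSeries A}
    (hy : seriesNorm ρ r y ≤ 4⁻¹) (z : PowerSeries A) :
    seriesNorm ρ r (formalBernoulliAd y z) ≤ 2 * seriesNorm ρ r z :=
  (seriesNorm_formalSum_le ρ r _).trans
    (tsum_seriesNorm_bernoulliAdTerm_le hy z)

theorem hasSum_bernoulliAdTerm_seriesEval {y z : PowerSeries A} (hy1 : y ∈ orderFil A 1)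
    (hy : seriesNorm ρ r y ≤ 4⁻¹) (hz : seriesNorm ρ r z ≠ ∞) :
    HasSum (bernoulliAdTerm (seriesEval ρ r y) (seriesEval ρ r z))
      (seriesEval ρ r (formalBernoulliAd y z)) := by
  have hy' : seriesNorm ρ r y ≠ ∞ := ne_top_of_le_ne_top (by simp) hy
  have h := hasSum_seriesEval_formalSum (ρ := ρ) (r := r)
    (fun m => bernoulliAdTerm_mem_orderFil hy1 (mem_orderFil_zero z) m)
    (ne_top_of_le_ne_top (ENNReal.mul_ne_top ENNReal.ofNat_ne_top hz)
      (tsum_seriesNorm_bernoulliAdTerm_le hy z))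
  rw [formalBernoulliAd]
  convert h using 2 with m
  rw [bernoulliAdTerm_eq, bernoulliAdTerm_eq,
    seriesEval_smul _ (seriesNorm_adEnd_pow_ne_top hy' hz m), seriesEval_adEnd_pow hy' hz]

end Evaluation

/-! ### Abel's theorem in a normed space -/

section Abel

variable {E : Type*} [NormedAddCommGroup E] [NormedSpace ℝ E] {f : ℕ → E} {L : E}

theorem summable_norm_pow_smul_of_bounded {C : ℝ} (h : ∀ n, ‖f n‖ ≤ C) {r : ℝ} (h0 : 0 ≤ r)
    (h1 : r < 1) : Summable fun n => ‖r ^ n • f n‖ := by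
  refine Summable.of_nonneg_of_le (fun n => norm_nonneg _) (fun n => ?_)
    ((summable_geometric_of_lt_one h0 h1).mul_right C)
  rw [norm_smul, Real.norm_of_nonneg (pow_nonneg h0 n)]
  exact mul_le_mul_of_nonneg_left (h n) (pow_nonneg h0 n)

theorem exists_norm_le_of_tendsto_sum
    (h : Tendsto (fun N => ∑ n ∈ Finset.range N, f n) atTop (𝓝 L)) : ∃ C, ∀ n, ‖f n‖ ≤ C := by
  have h0 : Tendsto f atTop (𝓝 0) := by
    have := ((tendsto_add_atTop_iff_nat 1).mpr h).sub h
    simpa [Finset.sum_range_succ] using this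
  obtain ⟨C, hC⟩ := h0.norm.bddAbove_range
  exact ⟨C, fun n => hC ⟨n, rfl⟩⟩

/-- Abel's limit theorem by summation by parts, with `e n` the error of the `n`-th partial sum. -/
theorem tendsto_hasSum_pow_smul_nhdsLT [CompleteSpace E]
    (h : Tendsto (fun N => ∑ n ∈ Finset.range N, f n) atTop (𝓝 L)) {g : ℝ → E}
    (hg : ∀ r, 0 ≤ r → r < 1 → HasSum (fun n => r ^ n • f n) (g r)) :
    Tendsto g (𝓝[<] 1) (𝓝 L) := by
  set e : ℕ → E := fun n => ∑ k ∈ Finset.range n, f k - L with he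
  have he0 : Tendsto e atTop (𝓝 0) := by simpa using h.sub_const L
  obtain ⟨C, hC⟩ := he0.norm.bddAbove_range
  have hCe (n : ℕ) : ‖e (n + 1)‖ ≤ C := hC ⟨n + 1, rfl⟩
  have hsum {r : ℝ} (h0 : 0 ≤ r) (h1 : r < 1) : Summable fun n => r ^ n • e (n + 1) :=
    (summable_norm_pow_smul_of_bounded hCe h0 h1).of_norm
  have hgr {r : ℝ} (h0 : 0 ≤ r) (h1 : r < 1) :
      g r - L = (1 - r) • ∑' n, r ^ n • e (n + 1) := by
    have hS := (hsum h0 h1).hasSum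
    set S := ∑' n, r ^ n • e (n + 1)
    -- The index shift produces `e 0 = -L`, which supplies the `- L` in `g r - L`.
    have hS' : HasSum (fun n => r ^ n • e n) (r • S + e 0) := by
      rw [← hasSum_nat_add_iff' 1]
      simpa [pow_succ', mul_smul] using hS.const_smul r
    have h2 := (hS.sub hS').unique (by
      convert hg r h0 h1 using 2 with n
      rw [← smul_sub, he]
      simp [Finset.sum_range_succ])
    rw [← h2, he]
    simp only [Finset.range_zero, Finset.sum_empty, sub_smul, one_smul]
    abel
  rw [Metric.tendsto_nhds]
  intro ε hε
  obtain ⟨N, hN⟩ := Metric.tendsto_atTop.mp he0 (ε / 2) (half_pos hε)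
  set K := ∑ n ∈ Finset.range N, ‖e (n + 1)‖ with hK
  have hlim : Tendsto (fun r : ℝ => (1 - r) * K) (𝓝[<] 1) (𝓝 0) := by
    have : Continuous fun r : ℝ => (1 - r) * K := by fun_prop
    simpa using (this.tendsto 1).mono_left nhdsWithin_le_nhds
  filter_upwards [hlim.eventually (gt_mem_nhds (half_pos hε)), self_mem_nhdsWithin,
    nhdsWithin_le_nhds (Ioi_mem_nhds (zero_lt_one (α := ℝ)))] with r hr h1 h0
  replace h0 : 0 ≤ r := le_of_lt h0
  replace h1 : r < 1 := h1
  rw [dist_eq_norm, hgr h0 h1, norm_smul, Real.norm_of_nonneg (by linarith)]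
  -- The first `N` errors contribute at most `K`, which the factor `1 - r` makes small; the
  -- remaining ones are below `ε / 2`, and `1 - r` cancels the geometric sum.
  have hbound : ‖∑' n, r ^ n • e (n + 1)‖ ≤ K + (1 - r)⁻¹ * (ε / 2) := by
    have hc : HasSum (fun n => if n ∈ Finset.range N then ‖e (n + 1)‖ else 0) K := by
      have := hasSum_sum_of_ne_finset_zero (L := SummationFilter.unconditional ℕ)
        (s := Finset.range N)
        (f := fun n => if n ∈ Finset.range N then ‖e (n + 1)‖ else 0) fun n hn => if_neg hn
      rwa [Finset.sum_congr rfl fun n hn => if_pos hn] at this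
    refine tsum_of_norm_bounded
      (hc.add ((hasSum_geometric_of_lt_one h0 h1).mul_right (ε / 2))) fun n => ?_
    rw [norm_smul, Real.norm_of_nonneg (pow_nonneg h0 n)]
    split_ifs with hn
    · have : r ^ n * ‖e (n + 1)‖ ≤ 1 * ‖e (n + 1)‖ :=
        mul_le_mul_of_nonneg_right (pow_le_one₀ h0 h1.le) (norm_nonneg _)
      have h3 : 0 ≤ r ^ n * (ε / 2) := by positivity
      linarith
    · rw [zero_add]
      refine mul_le_mul_of_nonneg_left ?_ (pow_nonneg h0 n)
      have := hN (n + 1) (by simp at hn; omega)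
      rw [dist_zero_right] at this
      exact this.le
  have h2 : (1 - r) * (K + (1 - r)⁻¹ * (ε / 2)) = (1 - r) * K + ε / 2 := by
    have : 1 - r ≠ 0 := by linarith
    field_simp
  have h4 := mul_le_mul_of_nonneg_left hbound (by linarith : 0 ≤ 1 - r)
  linarith

end Abel

section Convergence

variable {B : Type*} [NormedRing B] [NormedAlgebra ℝ B] [CompleteSpace B]

/-! ### The exponential of a convergent Magnus expansion -/

/-- The Picard estimate: each integration against `a` contributes a factor `M |s| / (n + 1)`. -/
theorem norm_iterated_riemann_le {a : C(ℝ, B)} {h : ℕ → C(ℝ, B)}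
    (hh : ∀ n, h (n + 1) = riemann (a * h n)) {T M K : ℝ} (hM : 0 ≤ M)
    (ha : ∀ s, |s| ≤ T → ‖a s‖ ≤ M) (hK : ∀ s, |s| ≤ T → ‖h 0 s‖ ≤ K) (n : ℕ) :
    ∀ s, |s| ≤ T → ‖h n s‖ ≤ K * ((M * |s|) ^ n / n.factorial) := by
  induction n with
  | zero => simpa using hK
  | succ n ih =>
    intro s hs
    -- Rescaling to `[0, 1]` treats both signs of `s` together.
    have h1 : h (n + 1) s = s • ∫ x in (0 : ℝ)..1, (a * h n) (s * x) := by
      rw [hh, riemann_apply, intervalIntegral.smul_integral_comp_mul_left]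
      simp
    have h2 : ‖∫ x in (0 : ℝ)..1, (a * h n) (s * x)‖ ≤
        ∫ x in (0 : ℝ)..1, M * (K * ((M * |s|) ^ n / n.factorial)) * x ^ n := by
      refine intervalIntegral.norm_integral_le_of_norm_le zero_le_one
        (Eventually.of_forall fun x hx => ?_) (Continuous.intervalIntegrable (by fun_prop) _ _)
      have hx0 : 0 ≤ x := hx.1.le
      have hsx : |s * x| ≤ T := by
        rw [abs_mul, abs_of_nonneg hx0]
        exact (mul_le_of_le_one_right (abs_nonneg s) hx.2).trans hs
      have h3 := ih (s * x) hsx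
      rw [ContinuousMap.mul_apply]
      refine (norm_mul_le _ _).trans
        ((mul_le_mul (ha _ hsx) h3 (norm_nonneg _) hM).trans (le_of_eq ?_))
      rw [abs_mul, abs_of_nonneg hx0]
      ring
    rw [intervalIntegral.integral_const_mul, integral_pow] at h2
    rw [h1, norm_smul, Real.norm_eq_abs]
    refine (mul_le_mul_of_nonneg_left h2 (abs_nonneg s)).trans (le_of_eq ?_)
    rw [Nat.factorial_succ]
    push_cast
    have : (n.factorial : ℝ) ≠ 0 := by positivity
    have : (n : ℝ) + 1 ≠ 0 := by positivity
    simp only [one_pow, ne_eq, Nat.add_eq_zero_iff, one_ne_zero, and_false, not_false_eq_true,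
      zero_pow, sub_zero]
    field_simp
    ring

theorem exists_norm_le_of_abs_le (f : C(ℝ, B)) (T : ℝ) :
    ∃ M, 0 ≤ M ∧ ∀ s, |s| ≤ T → ‖f s‖ ≤ M := by
  obtain ⟨M, hM⟩ := (isCompact_Icc (a := -T) (b := T)).exists_bound_of_continuousOn
    f.continuous.continuousOn
  exact ⟨max M 0, le_max_right _ _, fun s hs => (hM s (abs_le.mp hs)).trans (le_max_left _ _)⟩

/-- The order-by-order solution of `dF/dt = X a F`, `F(0) = 1` sums to the solution of
`dF/dt = a F`, `F(0) = 1`. -/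
theorem tendsto_sum_coeff_of_solvesIVP {a : C(ℝ, B)} {G : PowerSeries C(ℝ, B)}
    (hG0 : SeriesInitial G 1) (hG : HasSeriesDeriv G (PowerSeries.monomial 1 a * G))
    {F : ℝ → B} (hF : SolvesIVP a F) (t : ℝ) :
    Tendsto (fun N => ∑ n ∈ Finset.range N, PowerSeries.coeff n G t) atTop (𝓝 (F t)) := by
  have hcont : Continuous F := continuous_iff_continuousAt.mpr fun s => (hF.2 s).continuousAt
  let Fc : C(ℝ, B) := ⟨F, hcont⟩
  -- The remainders satisfy `h (n + 1) = R (a * h n)` with `h 0 = F`, so the Picard estimate sends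
  -- them to zero.
  set h : ℕ → C(ℝ, B) := fun N => Fc - ∑ n ∈ Finset.range N, PowerSeries.coeff n G with hh
  have hFR (s : ℝ) : F s = 1 + riemann (a * Fc) s := by
    rw [riemann_eq_sub_of_hasDerivAt (f := a * Fc) hF.2, hF.1, add_sub_cancel]
  have hGsucc (n : ℕ) : PowerSeries.coeff (n + 1) G = riemann (a * PowerSeries.coeff n G) := by
    ext s
    rw [hG.coeff_eq, hG0, coeff_succ_monomial_one_mul, PowerSeries.coeff_one,
      if_neg n.succ_ne_zero, zero_add]
  have hGzero (s : ℝ) : PowerSeries.coeff 0 G s = 1 := by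
    rw [hG.coeff_eq, hG0, coeff_zero_monomial_one_mul, PowerSeries.coeff_one, if_pos rfl,
      map_zero, ContinuousMap.zero_apply, add_zero]
  have hstep (n : ℕ) : h (n + 1) = riemann (a * h n) := by
    ext s
    simp only [hh, Finset.sum_range_succ', mul_sub, Finset.mul_sum, map_sub, map_sum,
      ContinuousMap.sub_apply, ContinuousMap.add_apply, hGzero, hGsucc]
    change F s - _ = _
    rw [hFR]
    abel
  obtain ⟨M, hM0, hM⟩ := exists_norm_le_of_abs_le a |t|
  obtain ⟨K, -, hK⟩ := exists_norm_le_of_abs_le Fc |t|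
  have hbound := fun n => norm_iterated_riemann_le hstep hM0 hM
    (K := K) (by simpa [hh] using hK) n t le_rfl
  have hlim : Tendsto (fun n => h n t) atTop (𝓝 0) := by
    refine squeeze_zero_norm hbound ?_
    simpa using (FloorSemiring.tendsto_pow_div_factorial_atTop (M * |t|)).const_mul K
  have := (tendsto_const_nhds (x := F t)).sub hlim
  simpa [hh, Fc, ContinuousMap.sum_apply] using this

/-- Evaluation at a point. -/
def evalHom (t : ℝ) : C(ℝ, B) →ₐ[ℝ] B where
  toFun f := f t
  map_zero' := rfl
  map_add' _ _ := rfl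
  map_one' := rfl
  map_mul' _ _ := rfl
  commutes' _ := rfl

theorem evalHom_apply (t : ℝ) (f : C(ℝ, B)) : evalHom t f = f t := rfl

theorem tsum_enorm_ne_top_of_summable_norm {E ι : Type*} [NormedAddCommGroup E] {f : ι → E}
    (h : Summable fun i => ‖f i‖) : ∑' i, ‖f i‖ₑ ≠ ∞ :=
  ENNReal.tsum_coe_ne_top_iff_summable.mpr (NNReal.summable_coe.mp h)

theorem seriesNorm_evalHom_ne_top {f : PowerSeries C(ℝ, B)} {t : ℝ} {L : B}
    (h : Tendsto (fun N => ∑ n ∈ Finset.range N, PowerSeries.coeff n f t) atTop (𝓝 L))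
    {r : ℝ} (h0 : 0 ≤ r) (h1 : r < 1) : seriesNorm (evalHom t) r f ≠ ∞ := by
  obtain ⟨C, hC⟩ := exists_norm_le_of_tendsto_sum h
  exact tsum_enorm_ne_top_of_summable_norm (summable_norm_pow_smul_of_bounded hC h0 h1)

theorem hasSum_seriesEval_evalHom {f : PowerSeries C(ℝ, B)} {t r : ℝ}
    (h : seriesNorm (evalHom t) r f ≠ ∞) :
    HasSum (fun n => r ^ n • PowerSeries.coeff n f t) (seriesEval (evalHom t) r f) := by
  have hf : (fun n => r ^ n • PowerSeries.coeff n f t) = mappedTerm (evalHom t) r f :=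
    funext fun n => by rw [mappedTerm, evalHom_apply]
  rw [hf]
  exact hasSum_seriesEval h

/-- Convergence at `t` may be only conditional, so the exponential identity cannot be evaluated
directly. Bounded terms give absolute convergence for `r < 1`, where evaluation commutes with `exp`;
Abel's theorem on both sides then reaches `r = 1`. -/
theorem eq_exp_of_tendsto_sum {a : C(ℝ, B)} {Ω : PowerSeries C(ℝ, B)}
    (hΩ : Ω ∈ orderFil C(ℝ, B) 1) (hG0 : SeriesInitial (formalExp Ω) 1)
    (hG : HasSeriesDeriv (formalExp Ω) (PowerSeries.monomial 1 a * formalExp Ω))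
    {F : ℝ → B} (hF : SolvesIVP a F) {t : ℝ} {L : B}
    (h : Tendsto (fun N => ∑ n ∈ Finset.range N, PowerSeries.coeff n Ω t) atTop (𝓝 L)) :
    F t = NormedSpace.exp L := by
  have hFt := tendsto_sum_coeff_of_solvesIVP hG0 hG hF t
  have h1 := tendsto_hasSum_pow_smul_nhdsLT h (g := fun r => seriesEval (evalHom t) r Ω)
    fun r h0 h1 => hasSum_seriesEval_evalHom (seriesNorm_evalHom_ne_top h h0 h1)
  have h2 := tendsto_hasSum_pow_smul_nhdsLT hFt
    (g := fun r => seriesEval (evalHom t) r (formalExp Ω))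
    fun r h0 h1 => hasSum_seriesEval_evalHom (seriesNorm_evalHom_ne_top hFt h0 h1)
  have hexp : Continuous (NormedSpace.exp : B → B) := by
    let _ : NormedAlgebra ℚ B := NormedAlgebra.restrictScalars ℚ ℝ B
    exact NormedSpace.exp_continuous
  refine tendsto_nhds_unique h2 (((hexp.tendsto L).comp h1).congr' ?_)
  filter_upwards [self_mem_nhdsWithin,
    nhdsWithin_le_nhds (Ioi_mem_nhds (zero_lt_one (α := ℝ)))] with r hr1 hr0
  exact (seriesEval_formalExp hΩ (seriesNorm_evalHom_ne_top h (le_of_lt hr0) hr1)).symm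

/-! ### Convergence for small times -/

/-- Restriction to the interval `[-ε, ε]`. -/
def restrictHom (ε : ℝ) : C(ℝ, B) →ₐ[ℝ] C(Set.Icc (-ε) ε, B) :=
  ContinuousMap.compRightAlgHom ℝ B ⟨Subtype.val, continuous_subtype_val⟩

theorem restrictHom_apply (ε : ℝ) (f : C(ℝ, B)) (s : Set.Icc (-ε) ε) :
    restrictHom ε f s = f s := rfl

theorem norm_apply_le_norm_restrictHom {ε t : ℝ} (ht : t ∈ Set.Icc (-ε) ε) (f : C(ℝ, B)) :
    ‖f t‖ ≤ ‖restrictHom ε f‖ :=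
  (restrictHom ε f).norm_coe_le_norm ⟨t, ht⟩

theorem norm_restrictHom_riemann_le {ε : ℝ} (hε : 0 ≤ ε) (f : C(ℝ, B)) :
    ‖restrictHom ε (riemann f)‖ ≤ ε * ‖restrictHom ε f‖ := by
  rw [ContinuousMap.norm_le _ (by positivity)]
  rintro ⟨t, ht⟩
  rw [restrictHom_apply, riemann_apply]
  have h := intervalIntegral.norm_integral_le_of_norm_le_const (a := 0) (b := t) (f := f)
    (C := ‖restrictHom ε f‖) fun s hs => norm_apply_le_norm_restrictHom (by
      rcases Set.mem_uIoc.mp hs with h | h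
      · exact ⟨by linarith [h.1], h.2.trans ht.2⟩
      · exact ⟨ht.1.trans h.1.le, by linarith [h.2]⟩) f
  rw [sub_zero, mul_comm] at h
  exact h.trans (mul_le_mul_of_nonneg_right (abs_le.mpr ht) (norm_nonneg _))

theorem mappedTerm_one {A D : Type*} [Ring A] [Algebra ℝ A] [NormedRing D] [NormedAlgebra ℝ D]
    (ρ : A →ₐ[ℝ] D) (f : PowerSeries A) (n : ℕ) :
    mappedTerm ρ 1 f n = ρ (PowerSeries.coeff n f) := by
  rw [mappedTerm, one_pow, one_smul]

theorem seriesNorm_evalHom_le {ε t : ℝ} (ht : t ∈ Set.Icc (-ε) ε) (f : PowerSeries C(ℝ, B)) :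
    seriesNorm (evalHom t) 1 f ≤ seriesNorm (restrictHom ε) 1 f := by
  refine ENNReal.tsum_le_tsum fun n => ?_
  rw [mappedTerm_one, mappedTerm_one, enorm_le_iff_norm_le]
  exact norm_apply_le_norm_restrictHom ht _

theorem seriesNorm_riemannSeries_le {ε : ℝ} (hε : 0 ≤ ε) (f : PowerSeries C(ℝ, B)) :
    seriesNorm (restrictHom ε) 1 (riemannSeries f) ≤
      ENNReal.ofReal ε * seriesNorm (restrictHom ε) 1 f := by
  rw [seriesNorm, seriesNorm, ← ENNReal.tsum_mul_left]
  refine ENNReal.tsum_le_tsum fun n => ?_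
  rw [mappedTerm_one, mappedTerm_one, coeff_riemannSeries, ← ofReal_norm, ← ofReal_norm,
    ← ENNReal.ofReal_mul hε]
  exact ENNReal.ofReal_le_ofReal (norm_restrictHom_riemann_le hε _)

/-- The first `N` coefficients of `χ` are those of `c N`, so every partial sum of the norm is
bounded by `C`. -/
theorem seriesNorm_le_of_forall_sub_mem {A D : Type*} [Ring A] [Algebra ℝ A] [NormedRing D]
    [NormedAlgebra ℝ D] {ρ : A →ₐ[ℝ] D} {r : ℝ} {c : ℕ → PowerSeries A} {χ : PowerSeries A}
    {C : ℝ≥0∞} (h : ∀ n, c n - χ ∈ orderFil A n) (hC : ∀ n, seriesNorm ρ r (c n) ≤ C) :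
    seriesNorm ρ r χ ≤ C := by
  rw [seriesNorm, ENNReal.tsum_eq_iSup_nat]
  refine iSup_le fun N => ?_
  refine le_trans (le_of_eq (Finset.sum_congr rfl fun n hn => ?_))
    ((ENNReal.sum_le_tsum (f := fun n => ‖mappedTerm ρ r (c N) n‖ₑ) (Finset.range N)).trans (hC N))
  have := h N n (Finset.mem_range.mp hn)
  rw [map_sub, sub_eq_zero] at this
  rw [mappedTerm, mappedTerm, this]

/-- The bound `2 ‖a‖` is preserved by the recursion: integration brings the norm below `4⁻¹`, and
then the Bernoulli series at most doubles that of `λ a`. -/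
theorem seriesNorm_zeroCBHD_le {a : C(ℝ, B)} {χ : PowerSeries C(ℝ, B)} {ε : ℝ} (hε : 0 ≤ ε)
    (hεa : ENNReal.ofReal ε * (2 * ‖restrictHom ε a‖ₑ) ≤ 4⁻¹)
    (h : ∀ n, (zeroCBHDStep a)^[n] (PowerSeries.monomial 1 a) - χ ∈ orderFil C(ℝ, B) n) :
    seriesNorm (restrictHom ε) 1 χ ≤ 2 * ‖restrictHom ε a‖ₑ := by
  have hmono : seriesNorm (restrictHom ε) 1 (PowerSeries.monomial 1 a) = ‖restrictHom ε a‖ₑ := by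
    rw [seriesNorm_monomial, one_smul]
  refine seriesNorm_le_of_forall_sub_mem h fun n => ?_
  induction n with
  | zero =>
    rw [Function.iterate_zero_apply, hmono, two_mul]
    exact le_self_add
  | succ n ih =>
    rw [Function.iterate_succ_apply', zeroCBHDStep, ← hmono]
    refine seriesNorm_formalBernoulliAd_le ?_ _
    exact (seriesNorm_riemannSeries_le hε _).trans ((mul_le_mul_right ih _).trans hεa)

/-! ### Local injectivity of `exp` and uniqueness of continuous logarithms -/

theorem exists_exp_injOn_ball :
    ∃ r : ℝ, 0 < r ∧ Set.InjOn (NormedSpace.exp : B → B) (Metric.ball 0 r) := by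
  have h : HasStrictFDerivAt (NormedSpace.exp : B → B)
      ((ContinuousLinearEquiv.refl ℝ B : B ≃L[ℝ] B) : B →L[ℝ] B) 0 :=
    hasStrictFDerivAt_exp_zero
  obtain ⟨r, hr, hsub⟩ := Metric.isOpen_iff.mp (h.toOpenPartialHomeomorph _).open_source 0
    h.mem_toOpenPartialHomeomorph_source
  exact ⟨r, hr, (h.toOpenPartialHomeomorph _).injOn.mono hsub⟩

/-- A continuous path starting at `0` is determined by its exponential, as long as some such path
is small. -/
theorem eqOn_of_exp_eq {r ε : ℝ} (hr : 0 < r)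
    (hinj : Set.InjOn (NormedSpace.exp : B → B) (Metric.ball 0 r)) {Ω y : ℝ → B}
    (hε : 0 ≤ ε) (hΩ : ContinuousOn Ω (Set.Icc (-ε) ε)) (hΩ0 : Ω 0 = 0)
    (hy : ∀ t ∈ Set.Icc (-ε) ε, ‖y t‖ ≤ r / 2)
    (hexp : ∀ t ∈ Set.Icc (-ε) ε, NormedSpace.exp (Ω t) = NormedSpace.exp (y t)) :
    ∀ t ∈ Set.Icc (-ε) ε, Ω t = y t := by
  have hsmall : ∀ t ∈ Set.Icc (-ε) ε, ‖Ω t‖ < r → Ω t = y t := fun t ht h =>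
    hinj (by simpa using h) (by simpa using (hy t ht).trans_lt (half_lt_self hr)) (hexp t ht)
  intro t ht
  refine hsmall t ht ?_
  by_contra! hlarge
  -- If `‖Ω‖` reached `r`, it would take the value `3r/4`. That is below `r`, which forces `Ω s = y
  -- s`, yet above the bound `r/2` on `y`.
  obtain ⟨s, hs, hs'⟩ := isPreconnected_Icc.intermediate_value
    (show (0 : ℝ) ∈ Set.Icc (-ε) ε from ⟨by linarith, hε⟩) ht hΩ.norm
    (show 3 * r / 4 ∈ Set.Icc ‖Ω 0‖ ‖Ω t‖ from
      ⟨by rw [hΩ0, norm_zero]; positivity, by linarith⟩)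
  have h1 := hsmall s hs (by simp only at hs'; linarith)
  have h2 := hy s hs
  rw [← h1] at h2
  simp only at hs'
  linarith

end Convergence

/-- The sup norm on `[-ε, ε]` gives continuity of the sum and integration term by term. The
Bernoulli identity is the formal fixed point equation evaluated at each `t`. -/
theorem convergence_of_seriesNorm_le {B : Type*} [NormedRing B] [NormedAlgebra ℝ B]
    [CompleteSpace B] {a : C(ℝ, B)} {χ : PowerSeries C(ℝ, B)} {ε : ℝ} (hε : 0 ≤ ε)
    (hχ : χ ∈ orderFil C(ℝ, B) 1) (hfix : χ = zeroCBHDStep a χ)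
    (hnorm : seriesNorm (restrictHom ε) 1 χ ≠ ∞)
    (hR : seriesNorm (restrictHom ε) 1 (riemannSeries χ) ≤ 4⁻¹) {x : ℝ → B}
    (hx : x = fun t => ∑' n, PowerSeries.coeff n χ t) :
    ContinuousOn x (Set.Icc (-ε) ε) ∧
    ∀ t ∈ Set.Icc (-ε) ε,
      Summable (fun n => ‖PowerSeries.coeff n χ t‖) ∧
      HasSum (fun n => PowerSeries.coeff n χ t) (x t) ∧
      HasSum (fun n => riemann (PowerSeries.coeff n χ) t) (∫ s in (0 : ℝ)..t, x s) ∧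
      HasSum (bernoulliAdTerm (∫ s in (0 : ℝ)..t, x s) (a t)) (x t) ∧
      ‖∫ s in (0 : ℝ)..t, x s‖ₑ ≤ seriesNorm (restrictHom ε) 1 (riemannSeries χ) := by
  have hsum : Summable fun n => ‖restrictHom ε (PowerSeries.coeff n χ)‖ := by
    simpa only [mappedTerm_one] using summable_norm_mappedTerm hnorm
  refine ⟨?_, fun t ht => ?_⟩
  · rw [hx]
    exact continuousOn_tsum (fun n => (PowerSeries.coeff n χ).continuous.continuousOn) hsum
      fun n t ht => norm_apply_le_norm_restrictHom ht _
  have hst : Summable fun n => ‖PowerSeries.coeff n χ t‖ :=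
    Summable.of_nonneg_of_le (fun _ => norm_nonneg _)
      (fun n => norm_apply_le_norm_restrictHom ht _) hsum
  have hsx : HasSum (fun n => PowerSeries.coeff n χ t) (x t) := by
    rw [hx]
    exact hst.of_norm.hasSum
  have hint : HasSum (fun n => riemann (PowerSeries.coeff n χ) t) (∫ s in (0 : ℝ)..t, x s) := by
    rw [hx]
    refine intervalIntegral.hasSum_intervalIntegral_of_summable_norm
      (Summable.of_nonneg_of_le (fun _ => norm_nonneg _) (fun n => ?_) hsum)
    rw [ContinuousMap.norm_le _ (norm_nonneg _)]
    rintro ⟨s, hs⟩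
    refine norm_apply_le_norm_restrictHom (Set.uIcc_subset_Icc ⟨?_, hε⟩ ht hs) _
    linarith
  have hRt := seriesNorm_evalHom_le ht (riemannSeries χ)
  have hevalR : seriesEval (evalHom t) 1 (riemannSeries χ) = ∫ s in (0 : ℝ)..t, x s := by
    rw [← hint.tsum_eq]
    refine tsum_congr fun n => ?_
    rw [mappedTerm_one, coeff_riemannSeries, evalHom_apply]
  have hevalχ : seriesEval (evalHom t) 1 χ = x t := by
    rw [← hsx.tsum_eq]
    refine tsum_congr fun n => ?_
    rw [mappedTerm_one, evalHom_apply]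
  refine ⟨hst, hsx, hint, ?_, ?_⟩
  · have h := hasSum_bernoulliAdTerm_seriesEval (ρ := evalHom t) (r := 1)
      (z := PowerSeries.monomial 1 a) (riemannSeries_mem_orderFil hχ) (hRt.trans hR)
      (by rw [seriesNorm_monomial]; exact enorm_ne_top)
    rw [seriesEval_monomial, one_smul, evalHom_apply, hevalR] at h
    have h2 : formalBernoulliAd (riemannSeries χ) (PowerSeries.monomial 1 a) = χ := hfix.symm
    rwa [h2, hevalχ] at h
  · rw [← hevalR]
    exact enorm_tsum_le_tsum_enorm.trans hRt

theorem exists_small_time {B : Type*} [NormedRing B] [NormedAlgebra ℝ B]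
    [CompleteSpace B] (a : C(ℝ, B)) {r : ℝ} (hr : 0 < r) :
    ∃ ε : ℝ, 0 < ε ∧ ENNReal.ofReal ε * (2 * ‖restrictHom ε a‖ₑ) ≤ 4⁻¹ ∧
      ENNReal.ofReal ε * (2 * ‖restrictHom ε a‖ₑ) ≤ ENNReal.ofReal r := by
  obtain ⟨M, hM0, hM⟩ := exists_norm_le_of_abs_le a 1
  -- The cap `1` makes the bound `M` for `a` independent of `ε`; the `+ 1` keeps the denominator
  -- positive.
  set ε := min 1 (min 4⁻¹ r / (2 * M + 1)) with hε
  have hpos : 0 < ε := by positivity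
  have hle : ENNReal.ofReal ε * (2 * ‖restrictHom ε a‖ₑ) ≤ ENNReal.ofReal (min 4⁻¹ r) := by
    have hn : ‖restrictHom ε a‖ ≤ M := by
      rw [ContinuousMap.norm_le _ hM0]
      rintro ⟨s, hs⟩
      exact hM s ((abs_le.mpr hs).trans (min_le_left _ _))
    rw [← ofReal_norm, ← ENNReal.ofReal_ofNat 2, ← ENNReal.ofReal_mul zero_le_two,
      ← ENNReal.ofReal_mul hpos.le]
    refine ENNReal.ofReal_le_ofReal ?_
    calc ε * (2 * ‖restrictHom ε a‖) ≤ min 4⁻¹ r / (2 * M + 1) * (2 * M + 1) :=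
          mul_le_mul (min_le_right _ _) (by linarith) (by positivity) (by positivity)
      _ = min 4⁻¹ r := div_mul_cancel₀ _ (by positivity)
  refine ⟨ε, hpos, hle.trans ?_, hle.trans (ENNReal.ofReal_le_ofReal (min_le_right _ _))⟩
  refine (ENNReal.ofReal_le_ofReal (min_le_left _ _)).trans (le_of_eq ?_)
  rw [ENNReal.ofReal_inv_of_pos (by norm_num), ENNReal.ofReal_ofNat]

end MagnusCBHD

end

theorem mainTheorem5 {B : Type*} [NormedRing B] [NormedAlgebra ℝ B] [CompleteSpace B]
    (a : C(ℝ, B)) :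
    ∃ χ : PowerSeries C(ℝ, B),
      -- `χ` is the value of the weight-zero CBHD recursion at `X a`, and the limit of its iterates
      (∀ ψ : PowerSeries C(ℝ, B),
        MagnusCBHD.IsZeroCBHD (MagnusCBHD.orderFil C(ℝ, B)) MagnusCBHD.riemannSeries
          (PowerSeries.monomial 1 a) ψ ↔ ψ = χ) ∧
      (∃ c : ℕ → PowerSeries C(ℝ, B),
        MagnusCBHD.IsZeroCBHDIteration (MagnusCBHD.orderFil C(ℝ, B)) MagnusCBHD.riemannSeries
          (PowerSeries.monomial 1 a) c ∧
        MagnusCBHD.FilTendsto (MagnusCBHD.orderFil C(ℝ, B)) c χ) ∧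
      -- Magnus' expansion is `R(χ)`, order by order
      (∀ Ω : PowerSeries C(ℝ, B),
        MagnusCBHD.IsMagnusExponent a Ω ↔ Ω = MagnusCBHD.riemannSeries χ) ∧
      (∀ Ω : PowerSeries C(ℝ, B),
        MagnusCBHD.SolvesMagnusODE a Ω ↔ Ω = MagnusCBHD.riemannSeries χ) ∧
      -- wherever the expansion converges, its sum is an exponent of the solution
      (∀ F : ℝ → B, MagnusCBHD.SolvesIVP a F → ∀ (t : ℝ) (L : B),
        Tendsto (fun N => ∑ n ∈ Finset.range N, MagnusCBHD.riemann (PowerSeries.coeff n χ) t)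
          atTop (𝓝 L) → F t = NormedSpace.exp L) ∧
      -- near `t = 0` everything converges, and the identity holds between functions
      (∃ ε : ℝ, 0 < ε ∧ ∃ x : ℝ → B, ContinuousOn x (Set.Icc (-ε) ε) ∧
        (∀ t ∈ Set.Icc (-ε) ε,
          Summable (fun n => ‖PowerSeries.coeff n χ t‖) ∧
          HasSum (fun n => PowerSeries.coeff n χ t) (x t) ∧
          HasSum (fun n => MagnusCBHD.riemann (PowerSeries.coeff n χ) t)
            (∫ s in (0 : ℝ)..t, x s) ∧
          HasSum (MagnusCBHD.bernoulliAdTerm (∫ s in (0 : ℝ)..t, x s) (a t)) (x t)) ∧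
        ∀ F : ℝ → B, MagnusCBHD.SolvesIVP a F →
          ∀ Ω : ℝ → B, ContinuousOn Ω (Set.Icc (-ε) ε) →
            ((Ω 0 = 0 ∧ ∀ t ∈ Set.Icc (-ε) ε, F t = NormedSpace.exp (Ω t)) ↔
              ∀ t ∈ Set.Icc (-ε) ε, Ω t = ∫ s in (0 : ℝ)..t, x s)) := by

  obtain ⟨χ, hχ, huniq, hlim⟩ := MagnusCBHD.exists_zeroCBHDStep_fixedPoint a
  have hfix : χ = MagnusCBHD.zeroCBHDStep a χ := (huniq χ hχ).mpr rfl
  have hRmem := MagnusCBHD.riemannSeries_mem_orderFil hχ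
  have hexp : ∀ F : ℝ → B, MagnusCBHD.SolvesIVP a F → ∀ (t : ℝ) (L : B),
      Tendsto (fun N => ∑ n ∈ Finset.range N, MagnusCBHD.riemann (PowerSeries.coeff n χ) t)
        atTop (𝓝 L) → F t = NormedSpace.exp L := by
    intro F hF t L h
    refine MagnusCBHD.eq_exp_of_tendsto_sum hRmem
      (MagnusCBHD.seriesInitial_formalExp (MagnusCBHD.seriesInitial_riemannSeries χ))
      (MagnusCBHD.hasSeriesDeriv_formalExp_riemannSeries hχ hfix) hF ?_
    simpa only [MagnusCBHD.coeff_riemannSeries] using h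
  refine ⟨χ, fun ψ => ?_, ⟨_, MagnusCBHD.isZeroCBHDIteration_iterate a, fun N => ?_⟩,
    MagnusCBHD.isMagnusExponent_iff hχ hfix, MagnusCBHD.solvesMagnusODE_iff hχ hfix huniq,
    hexp, ?_⟩
  · rw [MagnusCBHD.isZeroCBHD_iff]
    refine ⟨fun h => (huniq ψ h.1).mp h.2, ?_⟩
    rintro rfl
    exact ⟨hχ, hfix⟩
  · filter_upwards [eventually_ge_atTop N] with n hn
    exact MagnusCBHD.orderFil_anti hn (hlim n)
  obtain ⟨r, hr, hinj⟩ := MagnusCBHD.exists_exp_injOn_ball (B := B)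
  -- Besides the convergence condition `4⁻¹`, the expansion must stay within `r / 2`, half the
  -- injectivity radius, as `eqOn_of_exp_eq` requires.
  obtain ⟨ε, hε, hε4, hεr⟩ := MagnusCBHD.exists_small_time a (half_pos hr)
  have hnorm := MagnusCBHD.seriesNorm_zeroCBHD_le hε.le hε4 hlim
  have hR := (MagnusCBHD.seriesNorm_riemannSeries_le hε.le χ).trans (mul_le_mul_right hnorm _)
  obtain ⟨hcont, hconv⟩ := MagnusCBHD.convergence_of_seriesNorm_le hε.le hχ hfix
    (ne_top_of_le_ne_top (ENNReal.mul_ne_top ENNReal.ofNat_ne_top enorm_ne_top) hnorm)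
    (hR.trans hε4) rfl
  refine ⟨ε, hε, _, hcont, fun t ht => ?_, fun F hF Ω hΩ => ?_⟩
  · obtain ⟨h1, h2, h3, h4, -⟩ := hconv t ht
    exact ⟨h1, h2, h3, h4⟩
  have hFexp := fun t ht => hexp F hF t _ (hconv t ht).2.2.1.tendsto_sum_nat
  constructor
  · rintro ⟨hΩ0, hΩF⟩
    refine MagnusCBHD.eqOn_of_exp_eq hr hinj hε.le hΩ hΩ0 (fun t ht => ?_)
      fun t ht => (hΩF t ht).symm.trans (hFexp t ht)
    have h5 := (hconv t ht).2.2.2.2.trans (hR.trans hεr)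
    rwa [← ofReal_norm, ENNReal.ofReal_le_ofReal_iff (half_pos hr).le] at h5
  · intro h
    refine ⟨?_, fun t ht => by rw [h t ht]; exact hFexp t ht⟩
    rw [h 0 ⟨by linarith, hε.le⟩, intervalIntegral.integral_same]
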